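/- Let $I=[0,1]$ with its Borel $\sigma$-algebra and Lebesgue measure $m$, and let $K\ge 1$. For $k=1,\dots,K$ let $0<\alpha_k<1$ and let $T_k:I\to I$ be $$T_k(x)=\begin{cases}x(1+2^{\alpha_k}x^{\alpha_k}), & x\in[0,\tfrac12),\\ g_k(x), & x\in[\tfrac12,1],\end{cases}$$ where $g_k:[\tfrac12,1]\to[0,1]$ is differentiable (one-sidedly at the end points), $g_k(\tfrac12)=0$ and $g_k'(x)>1$ for all $x\in[\tfrac12,1]$. Let $p_1,\dots,p_K:I\to[0,1]$ be measurable with $\sum_k p_k(x)=1$ for all $x\in I$, and let $T=\{T_1,\dots,T_K;p_1,\dots,p_K\}$ be the position dependent random map with transition function $\mathbb P(x,A)=\sum_k p_k(x)\chi_A(T_k(x))$. A measure $\mu$ on $I$ is called $T$-invariant if $\mu(A)=\int_I\mathbb P(x,A)\,d\mu(x)$ for every Borel set $A$; an ACIM is a $T$-invariant Borel probability measure on $I$ that is absolutely continuous with respect to $m$. Let $T_{k,1}$ and $T_{k,2}$ be the restrictions of $T_k$ to $[0,\frac12)$ and $[\frac12,1]$. Assume: (A) for every $k$ and every $l\in\{1,2\}$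 the function $$x\mapsto\sum_{i=1}^{l}\frac{p_k(T_{k,i}^{-1}(x))}{T_{k,i}'(T_{k,i}^{-1}(x))}$$ is decreasing (i.e. non-increasing) on $[0,1)$, where the $i$-th term is $0$ if $x$ is not in the range of $T_{k,i}$, and derivatives at end points are one-sided; (B) there is $\delta>0$ with $\inf_{x\in I}p_k(x)\ge\delta$ for every $k$. Then: (i) $T$ has a unique ACIM $\mu$; write $d\mu=\rho\,dm$. (ii) The invariant density $\rho$ is uniformly bounded below: there is $c>0$ with $\rho\ge c$ $m$-almost everywhere on $I$. In particular this holds for $K=2$ with exponents $0<\alpha_2<\alpha_1<1$. -/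

import Mathlib

open MeasureTheory Set

noncomputable section

/-- The unit interval `I = [0,1]`, as a subset of the line. -/
def unitI : Set ℝ := Icc (0 : ℝ) 1

/-- Lebesgue measure `m` on `I`. -/
def leb : Measure ℝ := volume.restrict unitI

/-- The intermittent map with exponent `a` and right branch `g`:
`x (1 + 2^a x^a)` on `[0,1/2)` and `g x` on `[1/2,1]`. -/
def lsvMap (a : ℝ) (g : ℝ → ℝ) (x : ℝ) : ℝ :=
  if x < 1 / 2 then x * (1 + (2 : ℝ) ^ a * x ^ a) else g x

/-- The domain of the left branch (`i = 0`) and of the right branch (`i = 1`). -/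
def branchDom (i : Fin 2) : Set ℝ :=
  if i = 0 then Ico (0 : ℝ) (1 / 2) else Icc (1 / 2 : ℝ) 1

/-- A position dependent random map `{T_1, …, T_K; p_1, …, p_K}` built from intermittent maps.
Only the values of `g k` on `[1/2,1]` and of `p k` on `[0,1]` matter. -/
structure IntermittentRandomMap (K : ℕ) where
  /-- the exponents at the indifferent fixed point -/
  exponent : Fin K → ℝ
  /-- the right branches -/
  g : Fin K → ℝ → ℝ
  /-- the position dependent probabilities -/
  p : Fin K → ℝ → ℝ
  exponent_pos : ∀ k, 0 < exponent k
  exponent_lt_one : ∀ k, exponent k < 1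
  g_half : ∀ k, g k (1 / 2) = 0
  g_mapsTo : ∀ k, MapsTo (g k) (Icc (1 / 2 : ℝ) 1) unitI
  g_differentiable : ∀ k, DifferentiableOn ℝ (g k) (Icc (1 / 2 : ℝ) 1)
  one_lt_deriv_g : ∀ k, ∀ x ∈ Icc (1 / 2 : ℝ) 1, 1 < derivWithin (g k) (Icc (1 / 2 : ℝ) 1) x
  p_measurable : ∀ k, Measurable (p k)
  p_mem : ∀ k, ∀ x ∈ unitI, p k x ∈ Icc (0 : ℝ) 1
  p_sum : ∀ x ∈ unitI, ∑ k, p k x = 1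

namespace IntermittentRandomMap

variable {K : ℕ} (R : IntermittentRandomMap K)

/-- The constituent maps `T_k`. -/
def T (k : Fin K) : ℝ → ℝ := lsvMap (R.exponent k) (R.g k)

/-- The transition function `ℙ(x, A) = ∑_k p_k(x) χ_A(T_k(x))`. -/
def transition (x : ℝ) (A : Set ℝ) : ENNReal :=
  ∑ k, ENNReal.ofReal (R.p k x) * A.indicator 1 (R.T k x)

/-- `E_T μ (A) = ∫_I ℙ(x, A) dμ(x)`. -/
def pushMeasure (μ : Measure ℝ) (A : Set ℝ) : ENNReal :=
  ∫⁻ x in unitI, R.transition x A ∂μ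

/-- `μ` is invariant for the random map: `E_T μ (A) = μ(A)` for all Borel sets `A`. -/
def Invariant (μ : Measure ℝ) : Prop :=
  ∀ A : Set ℝ, MeasurableSet A → R.pushMeasure μ A = μ A

/-- `μ` is an absolutely continuous invariant (probability) measure of the random map on `I`. -/
structure IsACIM (μ : Measure ℝ) : Prop where
  isProbability : IsProbabilityMeasure μ
  absolutelyContinuous : μ ≪ leb
  invariant : R.Invariant μ

/-- The contribution `p_k(y) / T_k'(y)`, `y = T_{k,i}⁻¹(x)`, of the `i`-th branch of `T_k` at `x`.
As the branch is injective there is at most one such `y`; the term is `0` if there is none. At an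
endpoint of the branch the derivative is the one-sided one. -/
def branchTerm (k : Fin K) (i : Fin 2) (x : ℝ) : ℝ :=
  ∑ᶠ y ∈ {y | y ∈ branchDom i ∧ R.T k y = x}, R.p k y / derivWithin (R.T k) (branchDom i) y

/-- Condition (A): for each `k`, the partial sums of `p_k / T_k'` over the inverse branches, i.e.
the sum over the left branch alone and the sum over both branches, are decreasing (in the weak
sense). The point `x = 1`, which is not in the range of the left branch, is left out. -/
def ConditionA : Prop :=
  ∀ (k : Fin K) (l : Fin 2),
    AntitoneOn (fun x => ∑ i ∈ Finset.Iic l, R.branchTerm k i x) (Ico (0 : ℝ) 1)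

/-- Condition (B): the probabilities are bounded away from zero, `inf_I p_k ≥ δ > 0`. -/
def ConditionB : Prop :=
  ∃ δ : ℝ, 0 < δ ∧ ∀ k, ∀ x ∈ unitI, δ ≤ R.p k x

end IntermittentRandomMap

end

/-! Let `P` be the transfer operator on densities (`transfer`) and `U` its dual on test functions
(`dual`). The whole argument takes place on decreasing functions with values in `[0, ∞]`. Condition
(A) is exactly what makes `P` preserve monotonicity (`isDecreasing_transferOf`).

The danger is concentration of mass at the indifferent fixed point `0`. It is excluded by the cone
of decreasing `f` with `∫_0^x f ≤ C x^(1-a)`. By (B) any single map `T_k` is chosen with probability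
at least `δ`, so `a` can be the exponent of any fixed `k`. If `y` is the left `T_k`-preimage of `x`,
mass in `[y, x)` escapes `[0, x)` under `T_k`, while mass enters only from `[1/2, 1/2 + x)`. Since
`x^(1-a) - y^(1-a) ≥ (1-a)x/2`, the escape pays for the entry once `C` is large compared with the
total mass (`inCone_transfer`).

A function in the cone with mass at least `ε` is at least `ε/2` at a point `x₀` depending only on
`C`, `a` and `ε`. Backward left orbits reach `(0, x₀]`, so some fixed iterate `P^N f` is bounded
below by a constant `d > 0` on `(0, 1)` (`exists_forall_le_transfer_iterate`). Three conclusions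
follow.

Existence: Cesàro means of `P^n 1` have a pointwise limit along an ultrafilter. It is invariant, and
its mass is neither `0` nor infinite (`exists_invariant_density`).

Lower bound: an invariant density equals its own `N`-th iterate (`exists_pos_le_of_transfer_eq`).

Uniqueness: removing the common part `d` from two cone functions of equal mass, again and again,
leaves mass at most `ε`, so their images under `P^n` become indistinguishable (`coupling`). An
arbitrary density is close in `L¹` to a polynomial, hence to a difference of two decreasing
functions, and the coupling shows that every ACIM lies below the constructed one
(`measure_le_withDensity`). Two comparable probability measures coincide. -/

noncomputable section

/-! ### The left branch and its gain estimate -/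

/-- The left branch `x (1 + 2^a x^a)`, on the whole line. -/
def lsvLeft (a x : ℝ) : ℝ := x * (1 + (2 : ℝ) ^ a * x ^ a)

section LeftBranch

variable {a : ℝ}

lemma lsvLeft_zero : lsvLeft a 0 = 0 := by simp [lsvLeft]

lemma lsvLeft_half : lsvLeft a (1 / 2) = 1 := by
  have : (2 : ℝ) ^ a * (1 / 2) ^ a = 1 := by
    rw [← Real.mul_rpow (by norm_num) (by norm_num)]; norm_num
  rw [lsvLeft, this]; norm_num

lemma continuous_lsvLeft (ha : 0 < a) : Continuous (lsvLeft a) := by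
  unfold lsvLeft
  have := Real.continuous_rpow_const ha.le
  fun_prop

lemma strictMonoOn_lsvLeft (ha : 0 < a) : StrictMonoOn (lsvLeft a) (Ici 0) := by
  intro x hx y hy hxy
  have hx : 0 ≤ x := hx
  have h1 : x ^ a ≤ y ^ a := Real.rpow_le_rpow hx hxy.le ha.le
  have h2 : (0 : ℝ) < 2 ^ a := by positivity
  have h3 : 0 ≤ x ^ a := by positivity
  have h4 : (2 : ℝ) ^ a * x ^ a ≤ 2 ^ a * y ^ a := by gcongr
  unfold lsvLeft
  have h5 : 0 ≤ (2 : ℝ) ^ a * x ^ a := by positivity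
  nlinarith

lemma hasDerivAt_lsvLeft {x : ℝ} (hx : 0 < x) :
    HasDerivAt (lsvLeft a) (1 + (1 + a) * ((2 : ℝ) ^ a * x ^ a)) x := by
  have h := (hasDerivAt_id x).mul
    (((Real.hasDerivAt_rpow_const (p := a) (Or.inl hx.ne')).const_mul ((2 : ℝ) ^ a)).const_add 1)
  refine h.congr_deriv ?_
  have : x * x ^ (a - 1) = x ^ a := by
    rw [Real.rpow_sub_one hx.ne']; field_simp
  simp only [id]
  linear_combination (2 : ℝ) ^ a * a * this

lemma two_mul_rpow_le_one (ha : 0 < a) {x : ℝ} (hx : 0 ≤ x) (hx' : x ≤ 1 / 2) :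
    (2 : ℝ) ^ a * x ^ a ≤ 1 := by
  rw [← Real.mul_rpow (by norm_num) hx]
  exact Real.rpow_le_one (by linarith) (by linarith) ha.le

lemma le_lsvLeft {x : ℝ} (hx : 0 ≤ x) : x ≤ lsvLeft a x := by
  have : 0 ≤ (2 : ℝ) ^ a * x ^ a := by positivity
  unfold lsvLeft; nlinarith

lemma lsvLeft_le (ha : 0 < a) {x : ℝ} (hx : 0 ≤ x) (hx' : x ≤ 1 / 2) :
    lsvLeft a x ≤ 2 * x := by
  have := two_mul_rpow_le_one ha hx hx'
  unfold lsvLeft; nlinarith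

/-- The gain which keeps the mass from concentrating at the indifferent fixed point. -/
lemma rpow_sub_rpow_lsvLeft_ge (ha : 0 < a) (ha' : a < 1) {y : ℝ} (hy : 0 < y)
    (hy' : y ≤ 1 / 2) :
    (1 - a) / 2 * lsvLeft a y ≤ lsvLeft a y ^ (1 - a) - y ^ (1 - a) := by
  set x := lsvLeft a y with hx
  have hyx : y ≤ x := le_lsvLeft hy.le
  have hx2 : x ≤ 2 * y := lsvLeft_le ha hy.le hy'
  have hx0 : 0 < x := by linarith
  -- Bernoulli's inequality for the concave power `1 - a`; it reduces the claim to `x^(1-a) (1 -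
  -- y/x) ≥ x/2`.
  have h1 : (y / x) ^ (1 - a) ≤ 1 + (1 - a) * (y / x - 1) := by
    have := rpow_one_add_le_one_add_mul_self (s := y / x - 1) (p := 1 - a)
      (by have : 0 ≤ y / x := by positivity
          linarith) (by linarith) (by linarith)
    simpa using this
  rw [Real.div_rpow hy.le hx0.le, div_le_iff₀ (by positivity)] at h1
  have h2 : x - y = y * (2 ^ a * y ^ a) := by rw [hx, lsvLeft]; ring
  have h3 : x ^ (1 - a) * x ^ a = x := by
    rw [← Real.rpow_add hx0]; simp
  have h4 : x ^ a ≤ 2 ^ a * y ^ a := by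
    rw [← Real.mul_rpow (by norm_num) hy.le]
    exact Real.rpow_le_rpow hx0.le hx2 ha.le
  -- Here `1 - y/x = (y/x)(2y)^a`, and `x ≤ 2y` bounds the two factors below by `1/2` and `x^a`.
  have h5 : x ^ (1 - a) * (1 - y / x) ≥ x / 2 := by
    have : 1 - y / x = (y / x) * (2 ^ a * y ^ a) := by
      field_simp; rw [h2]; ring
    rw [this]
    have h6 : 1 / 2 ≤ y / x := by rw [div_le_div_iff₀ (by norm_num) hx0]; linarith
    calc x ^ (1 - a) * (y / x * (2 ^ a * y ^ a)) ≥ x ^ (1 - a) * (1 / 2 * x ^ a) := by gcongr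
      _ = x / 2 := by linear_combination (1 / 2) * h3
  nlinarith [mul_le_mul_of_nonneg_left h5 (by linarith : 0 ≤ 1 - a)]

end LeftBranch

/-! ### Branches, their inverses and the branch terms -/

namespace IntermittentRandomMap

variable {K : ℕ} (R : IntermittentRandomMap K)

lemma T_of_lt (k : Fin K) {x : ℝ} (hx : x < 1 / 2) : R.T k x = lsvLeft (R.exponent k) x := by
  simp only [T, lsvMap, if_pos hx, lsvLeft]

lemma T_of_ge (k : Fin K) {x : ℝ} (hx : 1 / 2 ≤ x) : R.T k x = R.g k x := by
  simp only [T, lsvMap, if_neg hx.not_gt]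

lemma strictMonoOn_g (k : Fin K) : StrictMonoOn (R.g k) (Icc (1 / 2) 1) := by
  refine strictMonoOn_of_deriv_pos (convex_Icc _ _) (R.g_differentiable k).continuousOn ?_
  intro x hx
  rw [interior_Icc] at hx
  rw [← derivWithin_of_mem_nhds (Icc_mem_nhds hx.1 hx.2)]
  linarith [R.one_lt_deriv_g k x (Ioo_subset_Icc_self hx)]

/-- Slope at least `1` from the value `0` at `1/2`. It confines the right-branch preimage of `[0,
x)` to `[1/2, 1/2 + x)`, for all maps at once. -/
lemma sub_half_le_g (k : Fin K) {x : ℝ} (hx : x ∈ Icc (1 / 2 : ℝ) 1) : x - 1 / 2 ≤ R.g k x := by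
  have h := (convex_Icc (1 / 2 : ℝ) 1).mul_sub_le_image_sub_of_le_deriv (f := R.g k) (C := 1)
    (R.g_differentiable k).continuousOn
    ((R.g_differentiable k).mono interior_subset) (by
      intro x hx
      rw [interior_Icc] at hx
      rw [← derivWithin_of_mem_nhds (Icc_mem_nhds hx.1 hx.2)]
      exact (R.one_lt_deriv_g k x (Ioo_subset_Icc_self hx)).le)
    (1 / 2) (by norm_num) x hx hx.1
  rw [R.g_half] at h
  linarith

lemma branchDom_zero : branchDom 0 = Ico 0 (1 / 2) := by simp [branchDom]

lemma branchDom_one : branchDom 1 = Icc (1 / 2) 1 := by simp [branchDom]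

lemma branchDom_subset (i : Fin 2) : branchDom i ⊆ unitI := by
  fin_cases i
  · intro x hx
    change x ∈ branchDom 0 at hx
    rw [branchDom_zero] at hx
    exact ⟨hx.1, by linarith [hx.2]⟩
  · intro x hx
    change x ∈ branchDom 1 at hx
    rw [branchDom_one] at hx
    exact ⟨by linarith [hx.1], hx.2⟩

lemma strictMonoOn_T (k : Fin K) (i : Fin 2) : StrictMonoOn (R.T k) (branchDom i) := by
  fin_cases i
  · change StrictMonoOn (R.T k) (branchDom 0)
    rw [branchDom_zero]
    refine ((strictMonoOn_lsvLeft (R.exponent_pos k)).mono Ico_subset_Ici_self).congr ?_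
    exact fun x hx => (R.T_of_lt k hx.2).symm
  · change StrictMonoOn (R.T k) (branchDom 1)
    rw [branchDom_one]
    exact (R.strictMonoOn_g k).congr fun x hx => (R.T_of_ge k hx.1).symm

lemma mapsTo_T (k : Fin K) : MapsTo (R.T k) unitI unitI := by
  intro x hx
  rcases lt_or_ge x (1 / 2) with h | h
  · rw [R.T_of_lt k h]
    exact ⟨hx.1.trans (le_lsvLeft hx.1),
      (lsvLeft_le (R.exponent_pos k) hx.1 h.le).trans (by linarith)⟩
  · rw [R.T_of_ge k h]
    exact R.g_mapsTo k ⟨h, hx.2⟩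

lemma derivWithin_T_left (k : Fin K) {y : ℝ} (hy : 0 < y) (hy' : y < 1 / 2) :
    HasDerivAt (R.T k) (1 + (1 + R.exponent k) * (2 ^ R.exponent k * y ^ R.exponent k)) y ∧
    derivWithin (R.T k) (branchDom 0) y =
      1 + (1 + R.exponent k) * (2 ^ R.exponent k * y ^ R.exponent k) := by
  have h : HasDerivAt (R.T k) _ y := (hasDerivAt_lsvLeft (a := R.exponent k) hy).congr_of_eventuallyEq (by
    filter_upwards [Iio_mem_nhds hy'] with x hx using R.T_of_lt k hx)
  refine ⟨h, ?_⟩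
  rw [branchDom_zero, derivWithin_of_mem_nhds (Ico_mem_nhds hy hy'), h.deriv]

lemma derivWithin_T_right (k : Fin K) {y : ℝ} (hy : y ∈ Icc (1 / 2 : ℝ) 1) :
    HasDerivWithinAt (R.T k) (derivWithin (R.T k) (branchDom 1) y) (Icc (1 / 2) 1) y ∧
    1 < derivWithin (R.T k) (branchDom 1) y := by
  have h : EqOn (R.T k) (R.g k) (Icc (1 / 2) 1) := fun x hx => R.T_of_ge k hx.1
  rw [branchDom_one, derivWithin_congr h (h hy)]
  exact ⟨((R.g_differentiable k) y hy).hasDerivWithinAt.congr h (h hy), R.one_lt_deriv_g k y hy⟩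

/-- Inside each branch the derivative is at least `1`. -/
lemma hasDerivWithinAt_T (k : Fin K) (i : Fin 2) {y : ℝ} (hy : y ∈ branchDom i) (hy0 : 0 < y) :
    HasDerivWithinAt (R.T k) (derivWithin (R.T k) (branchDom i) y) (branchDom i) y ∧
    1 ≤ derivWithin (R.T k) (branchDom i) y := by
  fin_cases i
  · change y ∈ branchDom 0 at hy
    have hy' := hy
    rw [branchDom_zero] at hy
    obtain ⟨h1, h2⟩ := R.derivWithin_T_left k hy0 hy.2
    have ha := R.exponent_pos k
    refine ⟨h1.hasDerivWithinAt.congr_deriv h2.symm, ?_⟩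
    change 1 ≤ derivWithin (R.T k) (branchDom 0) y
    rw [h2]
    have : 0 ≤ (1 + R.exponent k) * (2 ^ R.exponent k * y ^ R.exponent k) := by positivity
    linarith
  · change y ∈ branchDom 1 at hy
    have := branchDom_one
    rw [branchDom_one] at hy
    obtain ⟨h1, h2⟩ := R.derivWithin_T_right k hy
    refine ⟨?_, h2.le⟩
    change HasDerivWithinAt _ _ (branchDom 1) _
    rwa [this]

lemma surjOn_left (k : Fin K) {x : ℝ} (hx : x ∈ Ico (0 : ℝ) 1) :
    ∃ y ∈ branchDom 0, R.T k y = x := by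
  have h := intermediate_value_Ico (f := lsvLeft (R.exponent k)) (a := 0) (b := 1 / 2)
    (by norm_num) (continuous_lsvLeft (R.exponent_pos k)).continuousOn
  rw [lsvLeft_zero, lsvLeft_half] at h
  obtain ⟨y, hy, hyx⟩ := h hx
  exact ⟨y, by rwa [branchDom_zero], by rw [R.T_of_lt k hy.2, hyx]⟩

/-- The range of the right branch is an interval with left end point `0`. -/
lemma exists_right_preimage_of_le (k : Fin K) {x x' : ℝ} (hx : 0 ≤ x) (hxx' : x ≤ x')
    (h : ∃ y ∈ branchDom 1, R.T k y = x') : ∃ y ∈ branchDom 1, R.T k y = x := by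
  obtain ⟨y, hy, rfl⟩ := h
  rw [branchDom_one] at hy ⊢
  have h := intermediate_value_Icc (f := R.g k) hy.1
    ((R.g_differentiable k).continuousOn.mono (Icc_subset_Icc_right hy.2))
  rw [R.g_half] at h
  obtain ⟨z, hz, hzx⟩ := h ⟨hx, hxx'.trans_eq (R.T_of_ge k hy.1)⟩
  exact ⟨z, ⟨hz.1, hz.2.trans hy.2⟩, by rw [R.T_of_ge k hz.1, hzx]⟩

/-- The inverse of the `i`-th branch of `T_k`, with an unspecified value off its range. -/
def invBranch (k : Fin K) (i : Fin 2) : ℝ → ℝ := Function.invFunOn (R.T k) (branchDom i)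

lemma invBranch_T (k : Fin K) (i : Fin 2) {y : ℝ} (hy : y ∈ branchDom i) :
    R.invBranch k i (R.T k y) = y :=
  (R.strictMonoOn_T k i).injOn.leftInvOn_invFunOn hy

lemma branchTerm_T (k : Fin K) (i : Fin 2) {y : ℝ} (hy : y ∈ branchDom i) :
    R.branchTerm k i (R.T k y) = R.p k y / derivWithin (R.T k) (branchDom i) y := by
  have : {z | z ∈ branchDom i ∧ R.T k z = R.T k y} = {y} := by
    ext z
    refine ⟨fun hz => (R.strictMonoOn_T k i).injOn hz.1 hy hz.2, ?_⟩
    rintro rfl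
    exact ⟨hy, rfl⟩
  rw [branchTerm, this, finsum_mem_singleton]

lemma branchTerm_of_not_exists (k : Fin K) (i : Fin 2) {x : ℝ}
    (hx : ¬ ∃ y ∈ branchDom i, R.T k y = x) : R.branchTerm k i x = 0 := by
  have : {z | z ∈ branchDom i ∧ R.T k z = x} = ∅ := by
    ext z
    simp only [mem_ofPred_eq, mem_empty_iff_false, iff_false]
    exact fun hz => hx ⟨z, hz⟩
  rw [branchTerm, this, finsum_mem_empty]

lemma pos_of_T_pos (k : Fin K) {y : ℝ} (hy : y ∈ unitI) (h : 0 < R.T k y) : 0 < y := by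
  rcases hy.1.eq_or_lt with rfl | h0
  · rw [R.T_of_lt k (by norm_num), lsvLeft_zero] at h
    exact absurd h (lt_irrefl _)
  · exact h0

lemma branchTerm_nonneg (k : Fin K) (i : Fin 2) {x : ℝ} (hx : 0 < x) :
    0 ≤ R.branchTerm k i x := by
  by_cases h : ∃ y ∈ branchDom i, R.T k y = x
  · obtain ⟨y, hy, rfl⟩ := h
    rw [R.branchTerm_T k i hy]
    have h1 := (R.hasDerivWithinAt_T k i hy (R.pos_of_T_pos k (branchDom_subset i hy) hx)).2
    have h2 := (R.p_mem k y (branchDom_subset i hy)).1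
    positivity
  · rw [R.branchTerm_of_not_exists k i h]

lemma antitoneOn_branchTerm_left (hA : R.ConditionA) (k : Fin K) :
    AntitoneOn (R.branchTerm k 0) (Ico 0 1) := by
  have h := hA k 0
  have : Finset.Iic (0 : Fin 2) = {0} := by decide
  simpa only [this, Finset.sum_singleton] using h

lemma antitoneOn_branchTerm_add (hA : R.ConditionA) (k : Fin K) :
    AntitoneOn (fun x => R.branchTerm k 0 x + R.branchTerm k 1 x) (Ico 0 1) := by
  have h := hA k 1
  have : Finset.Iic (1 : Fin 2) = {0, 1} := by decide
  simpa only [this, Finset.sum_pair (zero_ne_one' (Fin 2))] using h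

lemma invBranch_left_spec (k : Fin K) {x : ℝ} (hx : x ∈ Ioo (0 : ℝ) 1) :
    R.invBranch k 0 x ∈ Ioo (0 : ℝ) (1 / 2) ∧ R.T k (R.invBranch k 0 x) = x ∧
      lsvLeft (R.exponent k) (R.invBranch k 0 x) = x := by
  obtain ⟨y, hy, rfl⟩ := R.surjOn_left k (Ioo_subset_Ico_self hx)
  rw [R.invBranch_T k 0 hy]
  have h0 := R.pos_of_T_pos k (branchDom_subset 0 hy) hx.1
  rw [branchDom_zero] at hy
  exact ⟨⟨h0, hy.2⟩, rfl, (R.T_of_lt k hy.2).symm⟩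

lemma invBranch_le_invBranch (k : Fin K) (i : Fin 2) {x x' : ℝ} (hxx' : x ≤ x')
    (hx : ∃ y ∈ branchDom i, R.T k y = x) (hx' : ∃ y ∈ branchDom i, R.T k y = x') :
    R.invBranch k i x ≤ R.invBranch k i x' := by
  obtain ⟨y, hy, rfl⟩ := hx
  obtain ⟨y', hy', rfl⟩ := hx'
  rw [R.invBranch_T k i hy, R.invBranch_T k i hy']
  exact ((R.strictMonoOn_T k i).le_iff_le hy hy').1 hxx'

/-- The constant `3` bounds the left slope: `1 + (1 + a)(2y)^a ≤ 2 + a < 3`. -/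
lemma branchTerm_left_ge {δ : ℝ} (hδ : 0 < δ) (hp : ∀ k, ∀ x ∈ unitI, δ ≤ R.p k x) (k : Fin K)
    {x : ℝ} (hx : x ∈ Ioo (0 : ℝ) 1) : δ / 3 ≤ R.branchTerm k 0 x := by
  obtain ⟨h1, h2, -⟩ := R.invBranch_left_spec k hx
  set y := R.invBranch k 0 x
  have hy : y ∈ branchDom 0 := by rw [branchDom_zero]; exact ⟨h1.1.le, h1.2⟩
  rw [← h2, R.branchTerm_T k 0 hy, (R.derivWithin_T_left k h1.1 h1.2).2]
  have ha := R.exponent_pos k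
  have ha' := R.exponent_lt_one k
  have h3 := two_mul_rpow_le_one ha h1.1.le h1.2.le
  have h4 : 0 ≤ (2 : ℝ) ^ R.exponent k * y ^ R.exponent k := by
    have := h1.1
    positivity
  have h5 := hp k y (branchDom_subset 0 hy)
  exact div_le_div₀ (hδ.le.trans h5) h5 (by positivity) (by nlinarith)

end IntermittentRandomMap

/-! ### Decreasing functions -/

/-- Nonnegative functions which are non-increasing on `(0, 1)` and vanish on `[1, ∞)`. -/
structure IsDecreasing (f : ℝ → ENNReal) : Prop where
  antitoneOn : AntitoneOn f (Ioi 0)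
  eq_zero : ∀ x, 1 ≤ x → f x = 0

lemma IsDecreasing.aemeasurable {f : ℝ → ENNReal} (hf : IsDecreasing f) :
    AEMeasurable f (volume.restrict (Ioo 0 1)) :=
  aemeasurable_restrict_of_antitoneOn measurableSet_Ioo
    (hf.antitoneOn.mono Ioo_subset_Ioi_self)

lemma IsDecreasing.of_Ioo {f : ℝ → ENNReal} (hf : AntitoneOn f (Ioo 0 1))
    (h0 : ∀ x, 1 ≤ x → f x = 0) : IsDecreasing f where
  antitoneOn x hx y _ hxy := by
    rcases lt_or_ge y 1 with h | h
    · exact hf ⟨hx, hxy.trans_lt h⟩ ⟨lt_of_lt_of_le hx hxy, h⟩ hxy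
    · rw [h0 y h]; exact zero_le
  eq_zero := h0

lemma leb_eq : leb = volume.restrict (Ioo 0 1) :=
  (Measure.restrict_congr_set Ioo_ae_eq_Icc).symm

/-! ### The transfer operator and its dual -/

namespace IntermittentRandomMap

variable {K : ℕ} (R : IntermittentRandomMap K)

/-- The transfer operator of `T_k` weighted by `p_k`. -/
def transferOf (k : Fin K) (f : ℝ → ENNReal) (x : ℝ) : ENNReal :=
  (Ioo (0 : ℝ) 1).indicator (fun x =>
    ENNReal.ofReal (R.branchTerm k 0 x) * f (R.invBranch k 0 x) +
    ENNReal.ofReal (R.branchTerm k 1 x) * f (R.invBranch k 1 x)) x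

/-- The transfer operator of the random map. -/
def transfer (f : ℝ → ENNReal) (x : ℝ) : ENNReal := ∑ k, R.transferOf k f x

/-- A Borel measurable version of `T_k`, equal to it on `[0,1]`. -/
def measurableT (k : Fin K) (x : ℝ) : ℝ :=
  if x < 1 / 2 then lsvLeft (R.exponent k) x else (Icc (1 / 2 : ℝ) 1).indicator (R.g k) x

/-- The dual (Koopman) operator of the random map. -/
def dual (φ : ℝ → ENNReal) (x : ℝ) : ENNReal :=
  ∑ k, ENNReal.ofReal (R.p k x) * φ (R.measurableT k x)

lemma measurableT_eq (k : Fin K) {x : ℝ} (hx : x ∈ unitI) : R.measurableT k x = R.T k x := by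
  unfold measurableT
  split_ifs with h
  · rw [R.T_of_lt k h]
  · have h' : 1 / 2 ≤ x := not_lt.1 h
    rw [R.T_of_ge k h', indicator_of_mem (show x ∈ Icc (1 / 2 : ℝ) 1 from ⟨h', hx.2⟩)]

lemma measurable_measurableT (k : Fin K) : Measurable (R.measurableT k) := by
  refine Measurable.ite measurableSet_Iio (continuous_lsvLeft (R.exponent_pos k)).measurable ?_
  classical
  rw [← piecewise_eq_indicator]
  exact (R.g_differentiable k).continuousOn.measurable_piecewise continuousOn_const
    measurableSet_Icc

lemma measurable_dual {φ : ℝ → ENNReal} (hφ : Measurable φ) : Measurable (R.dual φ) := by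
  unfold dual
  have h1 := R.p_measurable
  have h2 := R.measurable_measurableT
  exact Finset.measurable_sum _ fun k _ =>
    (h1 k).ennreal_ofReal.mul (hφ.comp (h2 k))

lemma measurable_dual_iterate {φ : ℝ → ENNReal} (hφ : Measurable φ) (n : ℕ) :
    Measurable (R.dual^[n] φ) := by
  induction n with
  | zero => exact hφ
  | succ n ih => rw [Function.iterate_succ_apply']; exact R.measurable_dual ih

lemma sum_ofReal_p {x : ℝ} (hx : x ∈ unitI) : ∑ k, ENNReal.ofReal (R.p k x) = 1 := by
  rw [← ENNReal.ofReal_sum_of_nonneg fun k _ => (R.p_mem k x hx).1, R.p_sum x hx,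
    ENNReal.ofReal_one]

lemma dual_le_one {φ : ℝ → ENNReal} (hφ : ∀ x ∈ unitI, φ x ≤ 1) :
    ∀ x ∈ unitI, R.dual φ x ≤ 1 := by
  intro x hx
  rw [← R.sum_ofReal_p hx]
  refine Finset.sum_le_sum fun k _ => mul_le_of_le_one_right zero_le (hφ _ ?_)
  rw [R.measurableT_eq k hx]
  exact R.mapsTo_T k hx

lemma dual_iterate_le_one {φ : ℝ → ENNReal} (hφ : ∀ x ∈ unitI, φ x ≤ 1) (n : ℕ) :
    ∀ x ∈ unitI, R.dual^[n] φ x ≤ 1 := by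
  induction n with
  | zero => exact hφ
  | succ n ih => rw [Function.iterate_succ_apply']; exact R.dual_le_one ih

lemma dual_one {x : ℝ} (hx : x ∈ unitI) : R.dual (fun _ => 1) x = 1 := by
  simp only [dual, mul_one, R.sum_ofReal_p hx]

/-- Abel summation. With weights `b₀, b₁` and values `f₀ ≥ f₁` of `f` at the left and right
preimages, `b₀f₀ + b₁f₁ = (b₀ + b₁)f₁ + b₀(f₀ - f₁)`. Condition (A) says that `b₀` and `b₀ + b₁`
decrease, and the inverse branches increase. -/
lemma isDecreasing_transferOf (hA : R.ConditionA) (k : Fin K) {f : ℝ → ENNReal}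
    (hf : IsDecreasing f) : IsDecreasing (R.transferOf k f) := by
  refine .of_Ioo ?_ fun x hx => indicator_of_notMem (fun h => h.2.not_ge hx) _
  intro x hx x' hx' hxx'
  rw [transferOf, transferOf, indicator_of_mem hx, indicator_of_mem hx']
  obtain ⟨hy1, hy2, -⟩ := R.invBranch_left_spec k hx
  obtain ⟨hy1', hy2', -⟩ := R.invBranch_left_spec k hx'
  have hIco := Ioo_subset_Ico_self (a := (0 : ℝ)) (b := 1)
  have hb0 := R.antitoneOn_branchTerm_left hA k (hIco hx) (hIco hx') hxx'
  have hb := R.antitoneOn_branchTerm_add hA k (hIco hx) (hIco hx') hxx'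
  have hleft : f (R.invBranch k 0 x') ≤ f (R.invBranch k 0 x) :=
    hf.antitoneOn hy1.1 hy1'.1 (R.invBranch_le_invBranch k 0 hxx'
      (R.surjOn_left k (hIco hx)) (R.surjOn_left k (hIco hx')))
  by_cases h : ∃ y ∈ branchDom 1, R.T k y = x'
  · have h' := R.exists_right_preimage_of_le k hx.1.le hxx' h
    have hmem : ∀ z, (∃ y ∈ branchDom 1, R.T k y = z) → 1 / 2 ≤ R.invBranch k 1 z := by
      rintro _ ⟨y, hy, rfl⟩
      rw [R.invBranch_T k 1 hy]
      rw [branchDom_one] at hy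
      exact hy.1
    have hpos : ∀ z : ℝ, 1 / 2 ≤ z → z ∈ Ioi (0 : ℝ) := fun z hz => lt_of_lt_of_le (by norm_num) hz
    have hright : f (R.invBranch k 1 x') ≤ f (R.invBranch k 1 x) :=
      hf.antitoneOn (hpos _ (hmem _ h')) (hpos _ (hmem _ h))
        (R.invBranch_le_invBranch k 1 hxx' h' h)
    have hcross : f (R.invBranch k 1 x') ≤ f (R.invBranch k 0 x') :=
      hf.antitoneOn hy1'.1 (hpos _ (hmem _ h)) (hy1'.2.le.trans (hmem _ h))
    -- `e` plays the role of `f₀ - f₁` at `x'`; an additive witness avoids truncated subtraction and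
    -- infinite values.
    obtain ⟨e, he⟩ := exists_add_of_le hcross
    have hb' := ENNReal.ofReal_le_ofReal hb
    simp only at hb'
    rw [ENNReal.ofReal_add (R.branchTerm_nonneg k 0 hx.1) (R.branchTerm_nonneg k 1 hx.1),
      ENNReal.ofReal_add (R.branchTerm_nonneg k 0 hx'.1) (R.branchTerm_nonneg k 1 hx'.1)] at hb'
    calc _ = (ENNReal.ofReal (R.branchTerm k 0 x') + ENNReal.ofReal (R.branchTerm k 1 x')) *
            f (R.invBranch k 1 x') + ENNReal.ofReal (R.branchTerm k 0 x') * e := by rw [he]; ring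
      _ ≤ (ENNReal.ofReal (R.branchTerm k 0 x) + ENNReal.ofReal (R.branchTerm k 1 x)) *
            f (R.invBranch k 1 x') + ENNReal.ofReal (R.branchTerm k 0 x) * e := by gcongr
      _ = ENNReal.ofReal (R.branchTerm k 0 x) * f (R.invBranch k 0 x') +
            ENNReal.ofReal (R.branchTerm k 1 x) * f (R.invBranch k 1 x') := by rw [he]; ring
      _ ≤ _ := by gcongr
  -- The right term is gone at the larger point `x'`, so comparing the left terms is enough.
  · rw [R.branchTerm_of_not_exists k 1 h, ENNReal.ofReal_zero, zero_mul, add_zero]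
    calc _ ≤ ENNReal.ofReal (R.branchTerm k 0 x) * f (R.invBranch k 0 x) := by gcongr
      _ ≤ _ := le_self_add

lemma isDecreasing_transfer (hA : R.ConditionA) {f : ℝ → ENNReal}
    (hf : IsDecreasing f) : IsDecreasing (R.transfer f) where
  antitoneOn _ hx _ hy hxy := Finset.sum_le_sum fun k _ =>
    (R.isDecreasing_transferOf hA k hf).antitoneOn hx hy hxy
  eq_zero x hx := Finset.sum_eq_zero fun k _ => (R.isDecreasing_transferOf hA k hf).eq_zero x hx

lemma isDecreasing_transfer_iterate (hA : R.ConditionA) {f : ℝ → ENNReal}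
    (hf : IsDecreasing f) (n : ℕ) : IsDecreasing (R.transfer^[n] f) := by
  induction n with
  | zero => exact hf
  | succ n ih => rw [Function.iterate_succ_apply']; exact R.isDecreasing_transfer hA ih

lemma measurableSet_branchDom (i : Fin 2) : MeasurableSet (branchDom i) := by
  fin_cases i
  · change MeasurableSet (branchDom 0)
    rw [branchDom_zero]; exact measurableSet_Ico
  · change MeasurableSet (branchDom 1)
    rw [branchDom_one]; exact measurableSet_Icc

lemma T_mem_Ioo (k : Fin K) (i : Fin 2) {y : ℝ} (hy : y ∈ branchDom i \ {0, 1 / 2, 1}) :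
    R.T k y ∈ Ioo (0 : ℝ) 1 := by
  obtain ⟨hy, hne⟩ := hy
  simp only [mem_insert_iff, mem_singleton_iff, not_or] at hne
  obtain ⟨h0, h1, h2⟩ := hne
  fin_cases i
  · change y ∈ branchDom 0 at hy
    rw [branchDom_zero] at hy
    have h0 : 0 < y := lt_of_le_of_ne hy.1 (Ne.symm h0)
    rw [R.T_of_lt k hy.2]
    refine ⟨h0.trans_le (le_lsvLeft h0.le), ?_⟩
    rw [← lsvLeft_half (a := R.exponent k)]
    exact strictMonoOn_lsvLeft (R.exponent_pos k) h0.le (by norm_num : (0:ℝ) ≤ 1 / 2) hy.2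
  · change y ∈ branchDom 1 at hy
    rw [branchDom_one] at hy
    have h1 : 1 / 2 < y := lt_of_le_of_ne hy.1 (Ne.symm h1)
    have h2 : y < 1 := lt_of_le_of_ne hy.2 h2
    rw [R.T_of_ge k hy.1]
    have h3 := R.strictMonoOn_g k (left_mem_Icc.2 (by norm_num)) hy h1
    have h4 := R.strictMonoOn_g k hy (right_mem_Icc.2 (by norm_num)) h2
    rw [R.g_half] at h3
    exact ⟨h3, h4.trans_le (R.g_mapsTo k (right_mem_Icc.2 (by norm_num))).2⟩

/-- Change of variables along one branch. -/
lemma lintegral_branch (k : Fin K) (i : Fin 2) (f φ : ℝ → ENNReal) :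
    ∫⁻ x in Ioo 0 1, ENNReal.ofReal (R.branchTerm k i x) * f (R.invBranch k i x) * φ x =
      ∫⁻ y in branchDom i, ENNReal.ofReal (R.p k y) * (f y * φ (R.T k y)) := by
  set F : ℝ → ENNReal :=
    fun x => ENNReal.ofReal (R.branchTerm k i x) * f (R.invBranch k i x) * φ x with hF
  -- Removing the end points costs nothing in measure, puts the image of `D` inside `(0, 1)`, and
  -- avoids the derivative at `0`.
  set D : Set ℝ := branchDom i \ {0, 1 / 2, 1} with hD
  have hfin : ({0, 1 / 2, 1} : Set ℝ).Finite := by simp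
  have hDm : MeasurableSet D := (measurableSet_branchDom i).diff hfin.measurableSet
  have hDae : D =ᵐ[volume] branchDom i := sdiff_null_ae_eq_self (hfin.measure_zero _)
  have hmono : MonotoneOn (R.T k) D := (R.strictMonoOn_T k i).monotoneOn.mono sdiff_subset
  have hDpos : ∀ y ∈ D, 0 < y := fun y hy =>
    R.pos_of_T_pos k (branchDom_subset i hy.1) (R.T_mem_Ioo k i hy).1
  have hderiv : ∀ y ∈ D,
      HasDerivWithinAt (R.T k) (derivWithin (R.T k) (branchDom i) y) D y := fun y hy =>
    (R.hasDerivWithinAt_T k i hy.1 (hDpos y hy)).1.mono sdiff_subset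
  have hcont : ContinuousOn (R.T k) D := fun y hy => (hderiv y hy).continuousWithinAt
  have himg : MeasurableSet (R.T k '' D) :=
    hDm.image_of_continuousOn_injOn hcont ((R.strictMonoOn_T k i).injOn.mono sdiff_subset)
  have h1 : ∫⁻ x in Ioo 0 1, F x = ∫⁻ x in R.T k '' D, F x := by
    rw [← lintegral_indicator measurableSet_Ioo, ← lintegral_indicator himg]
    refine lintegral_congr_ae ?_
    -- The right branch need not be onto, so `T_k 1` can be an interior point missed by the image of
    -- `D`; it is a null set.
    filter_upwards [compl_mem_ae_iff.2 (measure_singleton (R.T k 1))] with x hx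
    by_cases hxD : x ∈ R.T k '' D
    · obtain ⟨y, hy, rfl⟩ := hxD
      rw [indicator_of_mem (R.T_mem_Ioo k i hy), indicator_of_mem (mem_image_of_mem _ hy)]
    · rw [indicator_of_notMem hxD]
      by_cases hx01 : x ∈ Ioo (0 : ℝ) 1
      · rw [indicator_of_mem hx01, hF]
        have : ¬ ∃ y ∈ branchDom i, R.T k y = x := by
          rintro ⟨y, hy, rfl⟩
          refine hxD ⟨y, ⟨hy, ?_⟩, rfl⟩
          simp only [mem_insert_iff, mem_singleton_iff, not_or]
          refine ⟨?_, ?_, ?_⟩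
          · exact (R.pos_of_T_pos k (branchDom_subset i hy) hx01.1).ne'
          · rintro rfl
            have := hx01.1
            rw [R.T_of_ge k le_rfl, R.g_half] at this
            exact lt_irrefl _ this
          · rintro rfl
            exact hx rfl
        simp only [R.branchTerm_of_not_exists k i this, ENNReal.ofReal_zero, zero_mul]
      · rw [indicator_of_notMem hx01]
  rw [h1, lintegral_image_eq_lintegral_deriv_mul_of_monotoneOn hDm hderiv hmono,
    ← setLIntegral_congr hDae]
  refine setLIntegral_congr_fun hDm fun y hy => ?_
  have hd := (R.hasDerivWithinAt_T k i hy.1 (hDpos y hy)).2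
  have hd0 : 0 < derivWithin (R.T k) (branchDom i) y := by linarith
  simp only [hF]
  rw [R.branchTerm_T k i hy.1, R.invBranch_T k i hy.1, ← mul_assoc, ← mul_assoc,
    ← ENNReal.ofReal_mul hd0.le, mul_div_cancel₀ _ hd0.ne', mul_assoc]

lemma unitI_eq_union : unitI = branchDom 0 ∪ branchDom 1 := by
  rw [branchDom_zero, branchDom_one, unitI,
    Ico_union_Icc_eq_Icc (by norm_num) (by norm_num)]

/-- The transfer operator and the Koopman operator are dual to each other. -/
lemma lintegral_transfer_mul (hA : R.ConditionA) {f φ : ℝ → ENNReal} (hf : IsDecreasing f)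
    (hφ : Measurable φ) :
    ∫⁻ x in Ioo 0 1, R.transfer f x * φ x = ∫⁻ x in Ioo 0 1, f x * R.dual φ x := by
  have hk : ∀ k, ∫⁻ x in Ioo 0 1, R.transferOf k f x * φ x =
      ∫⁻ x in Ioo 0 1, f x * (ENNReal.ofReal (R.p k x) * φ (R.measurableT k x)) := by
    intro k
    have hIco := Ioo_subset_Ico_self (a := (0 : ℝ)) (b := 1)
    have hleft : AEMeasurable (fun x => ENNReal.ofReal (R.branchTerm k 0 x) *
        f (R.invBranch k 0 x) * φ x) (volume.restrict (Ioo 0 1)) := by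
      refine AEMeasurable.mul ?_ hφ.aemeasurable
      refine aemeasurable_restrict_of_antitoneOn measurableSet_Ioo fun x hx x' hx' hxx' => ?_
      exact mul_le_mul' (ENNReal.ofReal_le_ofReal
          (R.antitoneOn_branchTerm_left hA k (hIco hx) (hIco hx') hxx'))
        (hf.antitoneOn (R.invBranch_left_spec k hx).1.1 (R.invBranch_left_spec k hx').1.1
          (R.invBranch_le_invBranch k 0 hxx' (R.surjOn_left k (hIco hx))
            (R.surjOn_left k (hIco hx'))))
    calc ∫⁻ x in Ioo 0 1, R.transferOf k f x * φ x
        = ∫⁻ x in Ioo 0 1, (ENNReal.ofReal (R.branchTerm k 0 x) * f (R.invBranch k 0 x) * φ x +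
            ENNReal.ofReal (R.branchTerm k 1 x) * f (R.invBranch k 1 x) * φ x) := by
          refine setLIntegral_congr_fun measurableSet_Ioo fun x hx => ?_
          simp only [transferOf, indicator_of_mem hx, add_mul]
      _ = ∫⁻ y in unitI, ENNReal.ofReal (R.p k y) * (f y * φ (R.T k y)) := by
          rw [lintegral_add_left' hleft, R.lintegral_branch, R.lintegral_branch, unitI_eq_union,
            lintegral_union (measurableSet_branchDom 1)]
          rw [branchDom_zero, branchDom_one]
          exact disjoint_left.2 fun x hx hx' => hx.2.not_ge hx'.1
      _ = _ := by
          rw [unitI, ← setLIntegral_congr Ioo_ae_eq_Icc]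
          refine setLIntegral_congr_fun measurableSet_Ioo fun x hx => ?_
          simp only [R.measurableT_eq k (Ioo_subset_Icc_self hx)]
          ring
  simp only [transfer, dual, Finset.sum_mul, Finset.mul_sum]
  rw [lintegral_finsetSum', lintegral_finsetSum']
  · exact Finset.sum_congr rfl fun k _ => hk k
  · exact fun k _ => hf.aemeasurable.mul ((R.p_measurable k).ennreal_ofReal.mul
      (hφ.comp (R.measurable_measurableT k))).aemeasurable
  · exact fun k _ => (R.isDecreasing_transferOf hA k hf).aemeasurable.mul hφ.aemeasurable

lemma lintegral_transfer_iterate_mul (hA : R.ConditionA) {f φ : ℝ → ENNReal}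
    (hf : IsDecreasing f) (hφ : Measurable φ) (n : ℕ) :
    ∫⁻ x in Ioo 0 1, R.transfer^[n] f x * φ x = ∫⁻ x in Ioo 0 1, f x * R.dual^[n] φ x := by
  induction n generalizing φ with
  | zero => rfl
  | succ n ih =>
    rw [Function.iterate_succ_apply', Function.iterate_succ_apply,
      R.lintegral_transfer_mul hA (R.isDecreasing_transfer_iterate hA hf n) hφ,
      ih (R.measurable_dual hφ)]

lemma lintegral_transfer (hA : R.ConditionA) {f : ℝ → ENNReal} (hf : IsDecreasing f) :
    ∫⁻ x in Ioo 0 1, R.transfer f x = ∫⁻ x in Ioo 0 1, f x := by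
  have h := R.lintegral_transfer_mul hA hf (measurable_const (a := (1 : ENNReal)))
  simp only [mul_one] at h
  rw [h]
  refine setLIntegral_congr_fun measurableSet_Ioo fun x hx => ?_
  simp only [R.dual_one (Ioo_subset_Icc_self hx), mul_one]

lemma lintegral_transfer_iterate (hA : R.ConditionA) {f : ℝ → ENNReal} (hf : IsDecreasing f)
    (n : ℕ) : ∫⁻ x in Ioo 0 1, R.transfer^[n] f x = ∫⁻ x in Ioo 0 1, f x := by
  induction n with
  | zero => rfl
  | succ n ih =>
    rw [Function.iterate_succ_apply',
      R.lintegral_transfer hA (R.isDecreasing_transfer_iterate hA hf n), ih]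

end IntermittentRandomMap

/-! ### The cone of decreasing functions with controlled mass near the fixed point -/

lemma setLIntegral_Ioo_eq_mul_indicator {x : ℝ} (hx : x ≤ 1) (f : ℝ → ENNReal) :
    ∫⁻ z in Ioo 0 x, f z = ∫⁻ z in Ioo 0 1, f z * (Iio x).indicator 1 z := by
  have h : ∀ z, f z * (Iio x).indicator 1 z = (Iio x).indicator f z := fun z => by
    by_cases hz : z ∈ Iio x <;> simp [hz]
  simp only [h]
  rw [lintegral_indicator measurableSet_Iio, Measure.restrict_restrict measurableSet_Iio]
  congr 2
  ext z
  simp only [mem_Ioo, mem_inter_iff, mem_Iio]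
  exact ⟨fun h => ⟨h.2, h.1, h.2.trans_le hx⟩, fun h => ⟨h.2.1, h.1⟩⟩

lemma IsDecreasing.mul_le_lintegral {f : ℝ → ENNReal} (hf : IsDecreasing f) {x : ℝ}
    (hx : x ∈ Ioo (0 : ℝ) 1) : ENNReal.ofReal x * f x ≤ ∫⁻ z in Ioo 0 x, f z := by
  calc ENNReal.ofReal x * f x = ∫⁻ _ in Ioo 0 x, f x := by
        rw [setLIntegral_const, Real.volume_Ioo, sub_zero, mul_comm]
    _ ≤ _ := setLIntegral_mono' measurableSet_Ioo fun z hz =>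
        hf.antitoneOn hz.1 hx.1 hz.2.le

/-- Decreasing functions whose mass near the indifferent fixed point is controlled. -/
structure InCone (a C : ℝ) (f : ℝ → ENNReal) : Prop extends IsDecreasing f where
  lintegral_le : ∀ x ∈ Ioo (0 : ℝ) 1, ∫⁻ z in Ioo 0 x, f z ≤ ENNReal.ofReal (C * x ^ (1 - a))

/-- A function in the cone of mass at least `ε` is bounded below at a point depending only on the
cone and on `ε`. -/
lemma exists_forall_inCone_ge {a C : ℝ} (ha : a < 1) {ε : ℝ} (hε : 0 < ε) :
    ∃ x₀ ∈ Ioo (0 : ℝ) 1, ∀ f, InCone a C f → ENNReal.ofReal ε ≤ ∫⁻ z in Ioo 0 1, f z →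
      ENNReal.ofReal (ε / 2) ≤ f x₀ := by
  obtain ⟨x₀, hx₀, hC⟩ : ∃ x₀ ∈ Ioo (0 : ℝ) 1, C * x₀ ^ (1 - a) < ε / 2 := by
    have h1 : Filter.Tendsto (fun x : ℝ => C * x ^ (1 - a)) (nhdsWithin 0 (Ioi 0)) (nhds 0) := by
      have h2 : Continuous fun x : ℝ => C * x ^ (1 - a) :=
        continuous_const.mul (Real.continuous_rpow_const (by linarith))
      have h3 := h2.tendsto 0
      rw [Real.zero_rpow (by linarith), mul_zero] at h3
      exact h3.mono_left nhdsWithin_le_nhds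
    obtain ⟨x, hx1, hx2⟩ := ((h1.eventually_lt_const (by linarith : 0 < ε / 2)).and
      (Ioo_mem_nhdsGT one_pos)).exists
    exact ⟨x, hx2, hx1⟩
  refine ⟨x₀, hx₀, fun f hf hmass => ?_⟩
  -- The mass on `(0, x₀)` is at most `ε/2` by the choice of `x₀`; on `[x₀, 1)`, of length at most
  -- `1`, monotonicity gives at most `f x₀`.
  have hsplit : ∫⁻ z in Ioo 0 1, f z ≤ ENNReal.ofReal (ε / 2) + f x₀ := by
    rw [← Ioo_union_Ico_eq_Ioo hx₀.1 hx₀.2.le]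
    refine (lintegral_union_le _ _ _).trans (add_le_add ?_ ?_)
    · exact (hf.lintegral_le x₀ hx₀).trans (ENNReal.ofReal_le_ofReal hC.le)
    · calc ∫⁻ z in Ico x₀ 1, f z ≤ ∫⁻ _ in Ico x₀ 1, f x₀ :=
            setLIntegral_mono' measurableSet_Ico fun z hz =>
              hf.antitoneOn hx₀.1 (hx₀.1.trans_le hz.1) hz.1
        _ = f x₀ * ENNReal.ofReal (1 - x₀) := by rw [setLIntegral_const, Real.volume_Ico]
        _ ≤ f x₀ := mul_le_of_le_one_right zero_le (by
            rw [← ENNReal.ofReal_one]; exact ENNReal.ofReal_le_ofReal (by linarith [hx₀.1]))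
  have h := hmass.trans hsplit
  have h2 : ENNReal.ofReal ε = ENNReal.ofReal (ε / 2) + ENNReal.ofReal (ε / 2) := by
    rw [← ENNReal.ofReal_add (by linarith) (by linarith), add_halves]
  rw [h2] at h
  exact (ENNReal.add_le_add_iff_left ENNReal.ofReal_ne_top).1 h

/-! ### Invariance of the cone and spreading of positivity -/

namespace IntermittentRandomMap

variable {K : ℕ} (R : IntermittentRandomMap K)

/-- A bound on the chance of landing in `[0, x)` from `z`. From the right half this requires `z <
1/2 + x`. From the left half it requires `z < x`, since left branches move points to the right; and
for `z ≥ y`, the left `T_k`-preimage of `x`, the map `T_k` overshoots, which removes probability at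
least `δ`. -/
lemma dual_indicator_le {δ : ℝ} (hδ : 0 < δ) (hp : ∀ k, ∀ x ∈ unitI, δ ≤ R.p k x) (k : Fin K)
    {x z : ℝ} (hx : x ∈ Ioo (0 : ℝ) 1) (hz : z ∈ Ioo (0 : ℝ) 1) :
    R.dual ((Iio x).indicator 1) z ≤
      ENNReal.ofReal (1 - δ) * (Iio x).indicator 1 z +
      ENNReal.ofReal δ * (Iio (R.invBranch k 0 x)).indicator 1 z +
      (Ico (1 / 2) (1 / 2 + x)).indicator 1 z := by
  have hzI : z ∈ unitI := Ioo_subset_Icc_self hz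
  obtain ⟨hy1, hy2, hy3⟩ := R.invBranch_left_spec k hx
  set y := R.invBranch k 0 x
  have hδ1 : δ ≤ 1 := (hp k z hzI).trans (R.p_mem k z hzI).2
  have hyx : y ≤ x := by rw [← hy3]; exact le_lsvLeft hy1.1.le
  have hle1 : R.dual ((Iio x).indicator 1) z ≤ 1 :=
    R.dual_le_one (fun w _ => indicator_le_self' (f := 1) (fun _ _ => zero_le) w) z hzI
  have hzero : (∀ j, x ≤ R.T j z) → R.dual ((Iio x).indicator 1) z = 0 := fun h =>
    Finset.sum_eq_zero fun j _ => by
      rw [R.measurableT_eq j hzI, indicator_of_notMem (fun hj : R.T j z ∈ Iio x => (h j).not_gt hj), mul_zero]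
  rcases le_or_gt (1 / 2) z with hz2 | hz2
  · by_cases hzx : z < 1 / 2 + x
    · rw [indicator_of_mem (show z ∈ Ico (1 / 2) (1 / 2 + x) from ⟨hz2, hzx⟩)]
      exact hle1.trans le_add_self
    · rw [hzero fun j => ?_]
      · exact zero_le
      · rw [R.T_of_ge j hz2]
        have := R.sub_half_le_g j (x := z) ⟨hz2, hz.2.le⟩
        linarith
  · by_cases hzx : z < x
    · by_cases hzy : z < y
      · rw [indicator_of_mem (show z ∈ Iio x from hzx), indicator_of_mem (show z ∈ Iio y from hzy)]
        simp only [Pi.one_apply, mul_one]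
        rw [← ENNReal.ofReal_add (by linarith) hδ.le, sub_add_cancel, ENNReal.ofReal_one]
        exact hle1.trans le_self_add
      · rw [indicator_of_mem (show z ∈ Iio x from hzx), Pi.one_apply, mul_one, add_assoc]
        refine le_trans ?_ le_self_add
        have hk : (Iio x).indicator (1 : ℝ → ENNReal) (R.measurableT k z) = 0 := by
          rw [R.measurableT_eq k hzI]
          refine indicator_of_notMem (fun h => hzy ?_) _
          rw [R.T_of_lt k hz2, mem_Iio] at h
          exact ((strictMonoOn_lsvLeft (R.exponent_pos k)).lt_iff_lt hz.1.le hy1.1.le).1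
            (h.trans_eq hy3.symm)
        have hsum := R.sum_ofReal_p hzI
        rw [← Finset.add_sum_erase _ _ (Finset.mem_univ k)] at hsum
        rw [dual, ← Finset.add_sum_erase _ _ (Finset.mem_univ k), hk, mul_zero, zero_add]
        have h1 : ∑ j ∈ Finset.univ.erase k,
            ENNReal.ofReal (R.p j z) * (Iio x).indicator 1 (R.measurableT j z) ≤
            ∑ j ∈ Finset.univ.erase k, ENNReal.ofReal (R.p j z) :=
          Finset.sum_le_sum fun j _ => mul_le_of_le_one_right zero_le
            (indicator_le_self' (f := 1) (fun _ _ => zero_le) _)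
        refine h1.trans ?_
        rw [ENNReal.ofReal_sub _ hδ.le, ENNReal.ofReal_one]
        refine ENNReal.le_sub_of_add_le_left ENNReal.ofReal_ne_top ?_
        rw [← hsum]
        gcongr
        exact hp k z hzI
    · rw [hzero fun j => ?_]
      · exact zero_le
      · rw [R.T_of_lt j hz2]
        exact (not_lt.1 hzx).trans (le_lsvLeft hz.1.le)

/-- By duality and `dual_indicator_le`, the new mass on `(0, x)` is at most `(1-δ)∫_0^x f + δ∫_0^y f
+ ∫_{1/2}^{1/2+x} f`. The last term is at most `2Mx` because `f (1/2) ≤ 2M`; the gain is at least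
`δC(1-a)x/2`. The condition on `C` says that the gain wins. -/
lemma inCone_transfer (hA : R.ConditionA) {δ : ℝ} (hδ : 0 < δ)
    (hp : ∀ k, ∀ x ∈ unitI, δ ≤ R.p k x) (k : Fin K) {C M : ℝ} (hM : 0 ≤ M)
    (hC : 4 * M ≤ δ * C * (1 - R.exponent k)) {f : ℝ → ENNReal}
    (hf : InCone (R.exponent k) C f) (hfM : ∫⁻ z in Ioo 0 1, f z ≤ ENNReal.ofReal M) :
    InCone (R.exponent k) C (R.transfer f) where
  toIsDecreasing := R.isDecreasing_transfer hA hf.toIsDecreasing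
  lintegral_le x hx := by
    have ha := R.exponent_pos k
    have ha' := R.exponent_lt_one k
    have hhalf : (1 / 2 : ℝ) ∈ Ioo (0 : ℝ) 1 := by norm_num
    have hδ1 : δ ≤ 1 := (hp k _ (Ioo_subset_Icc_self hx)).trans
      (R.p_mem k _ (Ioo_subset_Icc_self hx)).2
    have hC0 : 0 ≤ C := by
      by_contra h
      have : δ * C * (1 - R.exponent k) < 0 :=
        mul_neg_of_neg_of_pos (mul_neg_of_pos_of_neg hδ (not_le.1 h)) (by linarith)
      linarith
    obtain ⟨hy1, hy2, hy3⟩ := R.invBranch_left_spec k hx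
    set y := R.invBranch k 0 x with hy
    have hyI : y ∈ Ioo (0 : ℝ) 1 := ⟨hy1.1, by linarith [hy1.2]⟩
    have hm : ∀ t : ℝ, Measurable ((Iio t).indicator (1 : ℝ → ENNReal)) := fun t =>
      measurable_one.indicator measurableSet_Iio
    have hfhalf : f (1 / 2) ≤ ENNReal.ofReal (2 * M) := by
      have h1 := (hf.mul_le_lintegral hhalf).trans
        ((lintegral_mono_set (Ioo_subset_Ioo_right hhalf.2.le)).trans hfM)
      calc f (1 / 2) = ENNReal.ofReal 2 * (ENNReal.ofReal (1 / 2) * f (1 / 2)) := by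
            rw [← mul_assoc, ← ENNReal.ofReal_mul (by norm_num)]; norm_num
        _ ≤ ENNReal.ofReal 2 * ENNReal.ofReal M := by gcongr
        _ = _ := (ENNReal.ofReal_mul (by norm_num)).symm
    have hright : ∫⁻ z in Ioo 0 1, f z * (Ico (1 / 2) (1 / 2 + x)).indicator 1 z ≤
        ENNReal.ofReal (2 * M) * ENNReal.ofReal x := by
      calc _ ≤ ∫⁻ z, (Ico (1 / 2) (1 / 2 + x)).indicator (fun _ => ENNReal.ofReal (2 * M)) z := by
            refine (setLIntegral_le_lintegral _ _).trans (lintegral_mono fun z => ?_)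
            by_cases hz : z ∈ Ico (1 / 2) (1 / 2 + x)
            · rw [indicator_of_mem hz, indicator_of_mem hz, Pi.one_apply, mul_one]
              exact (hf.antitoneOn hhalf.1 (hhalf.1.trans_le hz.1) hz.1).trans hfhalf
            · rw [indicator_of_notMem hz, indicator_of_notMem hz, mul_zero]
        _ = _ := by
            rw [lintegral_indicator measurableSet_Ico, setLIntegral_const, Real.volume_Ico,
              add_sub_cancel_left]
    have hgain := rpow_sub_rpow_lsvLeft_ge ha ha' hy1.1 hy1.2.le
    rw [hy3] at hgain
    calc ∫⁻ z in Ioo 0 x, R.transfer f z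
        = ∫⁻ z in Ioo 0 1, f z * R.dual ((Iio x).indicator 1) z := by
          rw [setLIntegral_Ioo_eq_mul_indicator hx.2.le,
            R.lintegral_transfer_mul hA hf.toIsDecreasing (hm x)]
      _ ≤ ∫⁻ z in Ioo 0 1, (ENNReal.ofReal (1 - δ) * (f z * (Iio x).indicator 1 z) +
            ENNReal.ofReal δ * (f z * (Iio y).indicator 1 z) +
            f z * (Ico (1 / 2) (1 / 2 + x)).indicator 1 z) := by
          refine setLIntegral_mono' measurableSet_Ioo fun z hz => ?_
          refine (mul_le_mul_right (R.dual_indicator_le hδ hp k hx hz) _).trans_eq ?_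
          rw [← hy]
          ring
      _ = ENNReal.ofReal (1 - δ) * (∫⁻ z in Ioo 0 x, f z) +
            ENNReal.ofReal δ * (∫⁻ z in Ioo 0 y, f z) +
            ∫⁻ z in Ioo 0 1, f z * (Ico (1 / 2) (1 / 2 + x)).indicator 1 z := by
          have hfx : ∀ t : ℝ, AEMeasurable (fun z => f z * (Iio t).indicator 1 z)
              (volume.restrict (Ioo 0 1)) := fun t => hf.aemeasurable.mul (hm t).aemeasurable
          rw [lintegral_add_left' (((hfx x).const_mul _).fun_add ((hfx y).const_mul _)),
            lintegral_add_left' ((hfx x).const_mul _), lintegral_const_mul'' _ (hfx x),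
            lintegral_const_mul'' _ (hfx y), ← setLIntegral_Ioo_eq_mul_indicator hx.2.le,
            ← setLIntegral_Ioo_eq_mul_indicator hyI.2.le]
      _ ≤ ENNReal.ofReal (1 - δ) * ENNReal.ofReal (C * x ^ (1 - R.exponent k)) +
            ENNReal.ofReal δ * ENNReal.ofReal (C * y ^ (1 - R.exponent k)) +
            ENNReal.ofReal (2 * M) * ENNReal.ofReal x := by
          gcongr
          · exact hf.lintegral_le x hx
          · exact hf.lintegral_le y hyI
      _ = ENNReal.ofReal ((1 - δ) * (C * x ^ (1 - R.exponent k)) +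
            δ * (C * y ^ (1 - R.exponent k)) + 2 * M * x) := by
          have h0 := hx.1
          have h1 := hy1.1
          have h2 : 0 ≤ 1 - δ := by linarith
          rw [← ENNReal.ofReal_mul h2, ← ENNReal.ofReal_mul hδ.le,
            ← ENNReal.ofReal_mul (by positivity), ← ENNReal.ofReal_add (by positivity)
            (by positivity), ← ENNReal.ofReal_add (by positivity) (by positivity)]
      _ ≤ _ := by
          refine ENNReal.ofReal_le_ofReal ?_
          have h1 := mul_le_mul_of_nonneg_left hgain (mul_nonneg hδ.le hC0)
          have h2 := mul_le_mul_of_nonneg_right hC hx.1.le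
          nlinarith

lemma inCone_transfer_iterate (hA : R.ConditionA) {δ : ℝ} (hδ : 0 < δ)
    (hp : ∀ k, ∀ x ∈ unitI, δ ≤ R.p k x) (k : Fin K) {C M : ℝ} (hM : 0 ≤ M)
    (hC : 4 * M ≤ δ * C * (1 - R.exponent k)) {f : ℝ → ENNReal}
    (hf : InCone (R.exponent k) C f) (hfM : ∫⁻ z in Ioo 0 1, f z ≤ ENNReal.ofReal M) (n : ℕ) :
    InCone (R.exponent k) C (R.transfer^[n] f) := by
  induction n with
  | zero => exact hf
  | succ n ih =>
    rw [Function.iterate_succ_apply']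
    exact R.inCone_transfer hA hδ hp k hM hC ih
      ((R.lintegral_transfer_iterate hA hf.toIsDecreasing n).trans_le hfM)

lemma le_transfer {δ : ℝ} (hδ : 0 < δ) (hp : ∀ k, ∀ x ∈ unitI, δ ≤ R.p k x) (k : Fin K)
    (f : ℝ → ENNReal) {x : ℝ} (hx : x ∈ Ioo (0 : ℝ) 1) :
    ENNReal.ofReal (δ / 3) * f (R.invBranch k 0 x) ≤ R.transfer f x := by
  calc _ ≤ R.transferOf k f x := by
        rw [transferOf, indicator_of_mem hx]
        refine le_trans ?_ le_self_add
        gcongr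
        exact R.branchTerm_left_ge hδ hp k hx
    _ ≤ _ := Finset.single_le_sum (f := fun k => R.transferOf k f x) (fun _ _ => zero_le)
        (Finset.mem_univ k)

lemma invBranch_iterate_mem (k : Fin K) {x : ℝ} (hx : x ∈ Ioo (0 : ℝ) 1) (n : ℕ) :
    (R.invBranch k 0)^[n] x ∈ Ioo (0 : ℝ) 1 := by
  induction n with
  | zero => exact hx
  | succ n ih =>
    rw [Function.iterate_succ_apply']
    have := (R.invBranch_left_spec k ih).1
    exact ⟨this.1, this.2.trans (by norm_num)⟩

lemma le_transfer_iterate {δ : ℝ} (hδ : 0 < δ) (hp : ∀ k, ∀ x ∈ unitI, δ ≤ R.p k x) (k : Fin K)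
    (f : ℝ → ENNReal) (n : ℕ) {x : ℝ} (hx : x ∈ Ioo (0 : ℝ) 1) :
    ENNReal.ofReal (δ / 3) ^ n * f ((R.invBranch k 0)^[n] x) ≤ R.transfer^[n] f x := by
  induction n generalizing f with
  | zero => simp
  | succ n ih =>
    rw [Function.iterate_succ_apply', Function.iterate_succ_apply]
    refine le_trans ?_ (ih (R.transfer f))
    rw [pow_succ, mul_assoc]
    gcongr
    exact R.le_transfer hδ hp k f (R.invBranch_iterate_mem k hx n)

/-- Backward orbits along the left branch converge to the indifferent fixed point. -/
lemma exists_invBranch_iterate_le (k : Fin K) {x₀ x : ℝ} (hx₀ : 0 < x₀) (hx : x ∈ Ioo (0 : ℝ) 1) :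
    ∃ n, (R.invBranch k 0)^[n] x ≤ x₀ := by
  by_contra! h
  set q : ℝ := 1 + 2 ^ R.exponent k * x₀ ^ R.exponent k
  have hq : 1 < q := by
    have : (0 : ℝ) < 2 ^ R.exponent k * x₀ ^ R.exponent k := by positivity
    simp only [q]; linarith
  have hstep : ∀ n, (R.invBranch k 0)^[n] x * q ^ n ≤ x := by
    intro n
    induction n with
    | zero => simp
    | succ n ih =>
      refine le_trans ?_ ih
      -- While the orbit stays above `x₀`, each backward step divides it by at least `q > 1`.
      have hn := R.invBranch_left_spec k (R.invBranch_iterate_mem k hx n)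
      have hlt := h (n + 1)
      rw [Function.iterate_succ_apply'] at hlt ⊢
      rw [pow_succ, mul_comm _ q, ← mul_assoc]
      gcongr
      nth_rewrite 2 [← hn.2.2]
      rw [lsvLeft]
      have := hn.1.1
      simp only [q]
      gcongr
      exact (R.exponent_pos k).le
  obtain ⟨n, hn⟩ := pow_unbounded_of_one_lt (x / x₀) hq
  have h1 := hstep n
  have h2 := h n
  rw [div_lt_iff₀ hx₀] at hn
  nlinarith [pow_pos (zero_lt_one.trans hq) n]

/-- Positivity near the indifferent fixed point spreads over the whole interval. -/
lemma exists_forall_le_transfer_iterate (hA : R.ConditionA) {δ : ℝ} (hδ : 0 < δ)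
    (hp : ∀ k, ∀ x ∈ unitI, δ ≤ R.p k x) (k : Fin K) {x₀ : ℝ} (hx₀ : 0 < x₀) :
    ∃ (N : ℕ) (c : ℝ), 0 < c ∧ ∀ f, IsDecreasing f → ∀ x ∈ Ioo (0 : ℝ) 1,
      ENNReal.ofReal c * f x₀ ≤ R.transfer^[N] f x := by
  have hhalf : (1 / 2 : ℝ) ∈ Ioo (0 : ℝ) 1 := by norm_num
  obtain ⟨n, hn⟩ := R.exists_invBranch_iterate_le k hx₀ hhalf
  -- The extra step makes `N` uniform in `x`: the left preimage of any `x` is below `1/2`, so by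
  -- monotonicity only the backward orbit of `1/2` matters.
  refine ⟨n + 1, (δ / 3) ^ (n + 1), by positivity, fun f hf x hx => ?_⟩
  have hy := (R.invBranch_left_spec k hx).1
  rw [Function.iterate_succ_apply']
  refine le_trans ?_ (R.le_transfer hδ hp k _ hx)
  rw [ENNReal.ofReal_pow (by positivity), pow_succ', mul_assoc]
  gcongr
  calc _ ≤ ENNReal.ofReal (δ / 3) ^ n * f ((R.invBranch k 0)^[n] (1 / 2)) := by
        gcongr
        exact hf.antitoneOn (R.invBranch_iterate_mem k hhalf n).1 hx₀ hn
    _ ≤ R.transfer^[n] f (1 / 2) := R.le_transfer_iterate hδ hp k f n hhalf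
    _ ≤ _ := (R.isDecreasing_transfer_iterate hA hf n).antitoneOn hy.1 hhalf.1 hy.2.le

end IntermittentRandomMap

/-! ### Stability of the cone and pointwise bounds -/

lemma InCone.mono {a C C' : ℝ} {f : ℝ → ENNReal} (hf : InCone a C f) (h : C ≤ C') :
    InCone a C' f where
  toIsDecreasing := hf.toIsDecreasing
  lintegral_le x hx := (hf.lintegral_le x hx).trans <| ENNReal.ofReal_le_ofReal <|
    mul_le_mul_of_nonneg_right h (Real.rpow_nonneg hx.1.le _)

/-- Bounded decreasing functions belong to a cone. -/
lemma IsDecreasing.inCone {f : ℝ → ENNReal} (hf : IsDecreasing f) {a C : ℝ} (ha : 0 ≤ a)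
    (hC : 0 ≤ C) (h : ∀ x ∈ Ioo (0 : ℝ) 1, f x ≤ ENNReal.ofReal C) : InCone a C f where
  toIsDecreasing := hf
  lintegral_le x hx := by
    calc ∫⁻ z in Ioo 0 x, f z ≤ ∫⁻ _ in Ioo 0 x, ENNReal.ofReal C :=
          setLIntegral_mono' measurableSet_Ioo fun z hz => h z ⟨hz.1, hz.2.trans hx.2⟩
      _ = ENNReal.ofReal (C * x) := by
          rw [setLIntegral_const, Real.volume_Ioo, sub_zero, ENNReal.ofReal_mul hC]
      _ ≤ _ := by
          refine ENNReal.ofReal_le_ofReal (mul_le_mul_of_nonneg_left ?_ hC)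
          simpa using Real.rpow_le_rpow_of_exponent_ge hx.1 hx.2.le (by linarith : 1 - a ≤ 1)

lemma InCone.const_mul {a C : ℝ} {f : ℝ → ENNReal} (hf : InCone a C f) {c : ℝ} (hc : 0 ≤ c) :
    InCone a (c * C) (fun x => ENNReal.ofReal c * f x) where
  antitoneOn x hx y hy hxy := by
    have := hf.antitoneOn hx hy hxy
    dsimp only
    gcongr
  eq_zero x hx := by rw [hf.eq_zero x hx, mul_zero]
  lintegral_le x hx := by
    rw [lintegral_const_mul' _ _ ENNReal.ofReal_ne_top, mul_assoc, ENNReal.ofReal_mul hc]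
    exact mul_le_mul_right (hf.lintegral_le x hx) _

/-- This makes the coupling iterable: removing a common constant does not leave the cone, and `C`
does not grow. -/
lemma InCone.sub_const {a C : ℝ} {f : ℝ → ENNReal} (hf : InCone a C f) (d : ENNReal) :
    InCone a C (fun x => f x - d) where
  antitoneOn x hx y hy hxy := tsub_le_tsub_right (hf.antitoneOn hx hy hxy) d
  eq_zero x hx := by rw [hf.eq_zero x hx, zero_tsub]
  lintegral_le x hx := (lintegral_mono fun _ => tsub_le_self).trans (hf.lintegral_le x hx)

lemma InCone.le_rpow {a C : ℝ} {f : ℝ → ENNReal} (hf : InCone a C f) {x : ℝ}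
    (hx : x ∈ Ioo (0 : ℝ) 1) : f x ≤ ENNReal.ofReal (C * x ^ (-a)) := by
  have h := (hf.mul_le_lintegral hx).trans (hf.lintegral_le x hx)
  have hx0 := hx.1
  calc f x = ENNReal.ofReal x⁻¹ * (ENNReal.ofReal x * f x) := by
        rw [← mul_assoc, ← ENNReal.ofReal_mul (by positivity), inv_mul_cancel₀ hx0.ne',
          ENNReal.ofReal_one, one_mul]
    _ ≤ ENNReal.ofReal x⁻¹ * ENNReal.ofReal (C * x ^ (1 - a)) := by gcongr
    _ = _ := by
        rw [← ENNReal.ofReal_mul (by positivity)]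
        congr 1
        rw [sub_eq_add_neg, Real.rpow_add hx0, Real.rpow_one]
        field_simp

/-- A converse to `InCone.le_rpow`, with a worse constant, from integrating `x^(-a)`. The pointwise
bound survives pointwise limits, so this returns the limit density to a cone. -/
lemma inCone_of_le_rpow {a C : ℝ} (ha : a < 1) (hC : 0 ≤ C) {f : ℝ → ENNReal}
    (hf : IsDecreasing f) (h : ∀ x ∈ Ioo (0 : ℝ) 1, f x ≤ ENNReal.ofReal (C * x ^ (-a))) :
    InCone a (C / (1 - a)) f where
  toIsDecreasing := hf
  lintegral_le x hx := by
    have hint : IntervalIntegrable (fun z : ℝ => C * z ^ (-a)) volume 0 x :=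
      (intervalIntegral.intervalIntegrable_rpow' (by linarith)).const_mul C
    have hint' : IntegrableOn (fun z : ℝ => C * z ^ (-a)) (Ioo 0 x) :=
      ((intervalIntegrable_iff_integrableOn_Ioo_of_le hx.1.le).1 hint)
    calc ∫⁻ z in Ioo 0 x, f z ≤ ∫⁻ z in Ioo 0 x, ENNReal.ofReal (C * z ^ (-a)) :=
          setLIntegral_mono' measurableSet_Ioo fun z hz => h z ⟨hz.1, hz.2.trans hx.2⟩
      _ = ENNReal.ofReal (∫ z in Ioo 0 x, C * z ^ (-a)) := by
          refine (ofReal_integral_eq_lintegral_ofReal hint' ?_).symm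
          refine (ae_restrict_mem measurableSet_Ioo).mono fun z hz => ?_
          exact mul_nonneg hC (Real.rpow_nonneg hz.1.le _)
      _ = ENNReal.ofReal (C / (1 - a) * x ^ (1 - a)) := by
          rw [← integral_Ioc_eq_integral_Ioo, ← intervalIntegral.integral_of_le hx.1.le,
            intervalIntegral.integral_const_mul, integral_rpow (Or.inl (by linarith)),
            Real.zero_rpow (by linarith)]
          congr 1
          rw [show -a + 1 = 1 - a by ring]
          ring

/-! ### Coupling -/

namespace IntermittentRandomMap

variable {K : ℕ} (R : IntermittentRandomMap K)

/-- The coupling argument: two members of a cone with the same mass become indistinguishable. -/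
lemma coupling (hA : R.ConditionA) {δ : ℝ} (hδ : 0 < δ) (hp : ∀ k, ∀ x ∈ unitI, δ ≤ R.p k x)
    (k : Fin K) {C M₀ : ℝ} (hM₀ : 0 ≤ M₀) (hC : 4 * M₀ ≤ δ * C * (1 - R.exponent k))
    {ε : ℝ} (hε : 0 < ε) :
    ∃ (N : ℕ) (d : ℝ), 0 < d ∧ ∀ (j : ℕ) (M : ℝ), M ≤ M₀ → M ≤ ε + j * d →
      ∀ f f', InCone (R.exponent k) C f → InCone (R.exponent k) C f' →
      ∫⁻ x in Ioo 0 1, f x = ENNReal.ofReal M → ∫⁻ x in Ioo 0 1, f' x = ENNReal.ofReal M →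
      ∀ n, j * N ≤ n → ∀ φ : ℝ → ENNReal, Measurable φ → (∀ x ∈ unitI, φ x ≤ 1) →
      ∫⁻ x in Ioo 0 1, f x * R.dual^[n] φ x ≤
        (∫⁻ x in Ioo 0 1, f' x * R.dual^[n] φ x) + ENNReal.ofReal ε := by
  obtain ⟨x₀, hx₀, hlow⟩ := exists_forall_inCone_ge (C := C) (R.exponent_lt_one k) hε
  obtain ⟨N, c, hc, hN⟩ := R.exists_forall_le_transfer_iterate hA hδ hp k hx₀.1
  set d := c * (ε / 2) with hd
  have hd0 : 0 < d := by positivity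
  -- Induction on the number `j` of removals. `M₀` and `C` stay fixed while the mass `M` drops by
  -- `d` per round, so the same `N` and `d` serve in every round.
  refine ⟨N, d, hd0, fun j => ?_⟩
  have htriv : ∀ M ≤ ε, ∀ f : ℝ → ENNReal, ∫⁻ x in Ioo 0 1, f x = ENNReal.ofReal M →
      ∀ n, ∀ φ : ℝ → ENNReal, (∀ x ∈ unitI, φ x ≤ 1) →
      ∫⁻ x in Ioo 0 1, f x * R.dual^[n] φ x ≤ ENNReal.ofReal ε := by
    intro M hM f hf n φ hφ
    refine le_trans ?_ (hf.trans_le (ENNReal.ofReal_le_ofReal hM))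
    exact setLIntegral_mono' measurableSet_Ioo fun x hx =>
      mul_le_of_le_one_right zero_le (R.dual_iterate_le_one hφ n x (Ioo_subset_Icc_self hx))
  induction j with
  | zero =>
    intro M _ hM f f' _ _ hfM _ n _ φ _ hφ
    exact (htriv M (by simpa using hM) f hfM n φ hφ).trans le_add_self
  | succ j ih =>
    intro M hMM hM f f' hf hf' hfM hfM' n hn φ hφm hφ
    rcases le_or_gt M ε with hMε | hMε
    · exact (htriv M hMε f hfM n φ hφ).trans le_add_self
    obtain ⟨n, rfl⟩ : ∃ n', n = N + n' := Nat.exists_eq_add_of_le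
      (by rw [Nat.succ_mul] at hn; omega)
    have hn' : j * N ≤ n := by rw [Nat.succ_mul] at hn; omega
    set ψ := R.dual^[n] φ
    have hψ : Measurable ψ := R.measurable_dual_iterate hφm n
    have key : ∀ f, InCone (R.exponent k) C f → ∫⁻ x in Ioo 0 1, f x = ENNReal.ofReal M →
        ∃ f₁, InCone (R.exponent k) C f₁ ∧ ∫⁻ x in Ioo 0 1, f₁ x = ENNReal.ofReal (M - d) ∧
          ∫⁻ x in Ioo 0 1, f x * R.dual^[N + n] φ x =
            (∫⁻ x in Ioo 0 1, f₁ x * ψ x) + ∫⁻ x in Ioo 0 1, ENNReal.ofReal d * ψ x := by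
      intro f hf hfM
      have hfN := R.inCone_transfer_iterate hA hδ hp k hM₀ hC hf
        (hfM.trans_le (ENNReal.ofReal_le_ofReal hMM)) N
      have hge : ∀ x ∈ Ioo (0 : ℝ) 1, ENNReal.ofReal d ≤ R.transfer^[N] f x := by
        intro x hx
        refine le_trans ?_ (hN f hf.toIsDecreasing x hx)
        rw [hd, ENNReal.ofReal_mul hc.le]
        gcongr
        exact hlow f hf (hfM ▸ ENNReal.ofReal_le_ofReal hMε.le)
      have hf₁ := hfN.sub_const (ENNReal.ofReal d)
      refine ⟨_, hf₁, ?_, ?_⟩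
      · rw [lintegral_sub' aemeasurable_const, R.lintegral_transfer_iterate hA hf.toIsDecreasing,
          hfM, setLIntegral_const, Real.volume_Ioo, sub_zero, ENNReal.ofReal_one, mul_one,
          ENNReal.ofReal_sub _ hd0.le]
        · rw [setLIntegral_const, Real.volume_Ioo]
          exact ENNReal.mul_ne_top ENNReal.ofReal_ne_top ENNReal.ofReal_ne_top
        · exact (ae_restrict_mem measurableSet_Ioo).mono hge
      · rw [Function.iterate_add_apply,
          ← R.lintegral_transfer_iterate_mul hA hf.toIsDecreasing hψ,
          ← lintegral_add_left' (hf₁.aemeasurable.fun_mul hψ.aemeasurable)]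
        refine setLIntegral_congr_fun measurableSet_Ioo fun x hx => ?_
        rw [← add_mul, tsub_add_cancel_of_le (hge x hx)]
    obtain ⟨f₁, hf₁, hf₁M, hfeq⟩ := key f hf hfM
    obtain ⟨f₂, hf₂, hf₂M, hfeq'⟩ := key f' hf' hfM'
    -- The removed part `d` contributes the same integral on both sides.
    rw [hfeq, hfeq', add_right_comm]
    gcongr
    refine ih (M - d) (by linarith) ?_ f₁ f₂ hf₁ hf₂ hf₁M hf₂M n hn' φ hφm hφ
    push_cast at hM
    linarith

/-- Two different cones are merged by enlarging the constant until the cone is also invariant for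
mass `M`. The bound is uniform in the test function `φ`. -/
lemma exists_forall_lintegral_dual_le (hA : R.ConditionA) {δ : ℝ} (hδ : 0 < δ)
    (hp : ∀ k, ∀ x ∈ unitI, δ ≤ R.p k x) (k : Fin K) {C C' M : ℝ} (hM : 0 ≤ M)
    {f f' : ℝ → ENNReal} (hf : InCone (R.exponent k) C f) (hf' : InCone (R.exponent k) C' f')
    (hfM : ∫⁻ x in Ioo 0 1, f x = ENNReal.ofReal M)
    (hfM' : ∫⁻ x in Ioo 0 1, f' x = ENNReal.ofReal M) {ε : ℝ} (hε : 0 < ε) :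
    ∃ N : ℕ, ∀ n ≥ N, ∀ φ : ℝ → ENNReal, Measurable φ → (∀ x ∈ unitI, φ x ≤ 1) →
      ∫⁻ x in Ioo 0 1, f x * R.dual^[n] φ x ≤
        (∫⁻ x in Ioo 0 1, f' x * R.dual^[n] φ x) + ENNReal.ofReal ε := by
  have ha : 0 < 1 - R.exponent k := by linarith [R.exponent_lt_one k]
  set C₀ := max (max C C') (4 * M / (δ * (1 - R.exponent k)))
  have hC₀ : 4 * M ≤ δ * C₀ * (1 - R.exponent k) := by
    have h : 4 * M / (δ * (1 - R.exponent k)) ≤ C₀ := le_max_right _ _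
    rw [div_le_iff₀ (by positivity)] at h
    linarith
  obtain ⟨N, d, hd, h⟩ := R.coupling hA hδ hp k hM hC₀ hε
  obtain ⟨j, hj⟩ := exists_nat_gt (M / d)
  rw [div_lt_iff₀ hd] at hj
  exact ⟨j * N, h j M le_rfl (by linarith) f f'
    (hf.mono ((le_max_left _ _).trans (le_max_left _ _)))
    (hf'.mono ((le_max_right _ _).trans (le_max_left _ _))) hfM hfM'⟩

end IntermittentRandomMap

/-! ### Cesàro means and the invariant density -/

/-- The Cesàro mean of the first `n + 1` terms of a sequence of functions. -/
def cesaro (f : ℕ → ℝ → ENNReal) (n : ℕ) (x : ℝ) : ENNReal :=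
  ((n + 1 : ℕ) : ENNReal)⁻¹ * ∑ i ∈ Finset.range (n + 1), f i x

lemma natCast_succ_inv_mul_self (n : ℕ) (c : ENNReal) :
    ((n + 1 : ℕ) : ENNReal)⁻¹ * (((n + 1 : ℕ) : ENNReal) * c) = c := by
  rw [← mul_assoc, ENNReal.inv_mul_cancel (by simp) (ENNReal.natCast_ne_top _), one_mul]

lemma le_cesaro {f : ℕ → ℝ → ENNReal} {c : ENNReal} {x : ℝ} (h : ∀ i, c ≤ f i x) (n : ℕ) :
    c ≤ cesaro f n x := by
  rw [← natCast_succ_inv_mul_self n c, cesaro]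
  gcongr
  calc _ = ∑ i ∈ Finset.range (n + 1), c := by simp
    _ ≤ _ := Finset.sum_le_sum fun i _ => h i

lemma cesaro_le {f : ℕ → ℝ → ENNReal} {c : ENNReal} {x : ℝ} (h : ∀ i, f i x ≤ c) (n : ℕ) :
    cesaro f n x ≤ c := by
  rw [← natCast_succ_inv_mul_self n c, cesaro]
  gcongr
  calc _ ≤ ∑ i ∈ Finset.range (n + 1), c := Finset.sum_le_sum fun i _ => h i
    _ = _ := by simp

/-- A pointwise limit of the Cesàro means along a nonprincipal ultrafilter. -/
lemma exists_tendsto_cesaro (f : ℕ → ℝ → ENNReal) :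
    ∃ h : ℝ → ENNReal, ∀ x, Filter.Tendsto (fun n => cesaro f n x)
      (Filter.hyperfilter ℕ : Filter ℕ) (nhds (h x)) :=
  ⟨fun x => ((Filter.hyperfilter ℕ).map fun n => cesaro f n x).lim,
    fun _ => Ultrafilter.le_nhds_lim _⟩

lemma tendsto_natCast_succ_inv_mul {c : ENNReal} (hc : c ≠ ⊤) {u : ℕ → ENNReal}
    (hu : ∀ n, u n ≤ c) :
    Filter.Tendsto (fun n : ℕ => ((n + 1 : ℕ) : ENNReal)⁻¹ * u n)
      (Filter.hyperfilter ℕ : Filter ℕ) (nhds 0) := by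
  have h1 : Filter.Tendsto (fun n : ℕ => ((n + 1 : ℕ) : ENNReal)⁻¹) Filter.atTop (nhds 0) :=
    ENNReal.tendsto_inv_nat_nhds_zero.comp (Filter.tendsto_add_atTop_nat 1)
  have h2 := ENNReal.Tendsto.mul_const h1 (Or.inr hc)
  rw [zero_mul] at h2
  have h3 : (Filter.hyperfilter ℕ : Filter ℕ) ≤ Filter.atTop := by
    rw [← Nat.cofinite_eq_atTop]
    exact Filter.hyperfilter_le_cofinite
  exact tendsto_of_tendsto_of_tendsto_of_le_of_le tendsto_const_nhds (h2.mono_left h3)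
    (fun _ => zero_le) fun n => mul_le_mul_right (hu n) _

lemma isDecreasing_indicator_one : IsDecreasing ((Ioo (0 : ℝ) 1).indicator 1) :=
  .of_Ioo (fun x hx y hy _ => by rw [indicator_of_mem hx, indicator_of_mem hy]; simp)
    fun _ hx => indicator_of_notMem (fun h => h.2.not_ge hx) _

namespace IntermittentRandomMap

variable {K : ℕ} (R : IntermittentRandomMap K)

lemma transfer_of_notMem (f : ℝ → ENNReal) {x : ℝ} (hx : x ∉ Ioo (0 : ℝ) 1) :
    R.transfer f x = 0 :=
  Finset.sum_eq_zero fun _ _ => indicator_of_notMem hx _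

lemma transfer_add (f f' : ℝ → ENNReal) (x : ℝ) :
    R.transfer (fun x => f x + f' x) x = R.transfer f x + R.transfer f' x := by
  rw [transfer, transfer, transfer, ← Finset.sum_add_distrib]
  refine Finset.sum_congr rfl fun k _ => ?_
  by_cases hx : x ∈ Ioo (0 : ℝ) 1
  · simp only [transferOf, indicator_of_mem hx]; ring
  · simp only [transferOf, indicator_of_notMem hx, add_zero]

lemma transfer_const_mul (c : ENNReal) (f : ℝ → ENNReal) (x : ℝ) :
    R.transfer (fun x => c * f x) x = c * R.transfer f x := by
  rw [transfer, transfer, Finset.mul_sum]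
  refine Finset.sum_congr rfl fun k _ => ?_
  by_cases hx : x ∈ Ioo (0 : ℝ) 1
  · simp only [transferOf, indicator_of_mem hx]; ring
  · simp only [transferOf, indicator_of_notMem hx, mul_zero]

lemma transfer_sum (f : ℕ → ℝ → ENNReal) (n : ℕ) (x : ℝ) :
    R.transfer (fun x => ∑ i ∈ Finset.range n, f i x) x =
      ∑ i ∈ Finset.range n, R.transfer (f i) x := by
  induction n with
  | zero =>
    have := R.transfer_const_mul 0 (fun _ => 0) x
    simpa using this
  | succ n ih => simp only [Finset.sum_range_succ, R.transfer_add, ih]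

/-- At each point the operator is a finite combination of point values with finite weights, so
pointwise convergence suffices, along any filter. -/
lemma tendsto_transfer {l : Filter ℕ} {u : ℕ → ℝ → ENNReal} {h : ℝ → ENNReal}
    (hu : ∀ x, Filter.Tendsto (fun n => u n x) l (nhds (h x))) (x : ℝ) :
    Filter.Tendsto (fun n => R.transfer (u n) x) l (nhds (R.transfer h x)) := by
  refine tendsto_finsetSum _ fun k _ => ?_
  by_cases hx : x ∈ Ioo (0 : ℝ) 1
  · simp only [transferOf, indicator_of_mem hx]
    exact (ENNReal.Tendsto.const_mul (hu _) (Or.inr ENNReal.ofReal_ne_top)).add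
      (ENNReal.Tendsto.const_mul (hu _) (Or.inr ENNReal.ofReal_ne_top))
  · simp only [transferOf, indicator_of_notMem hx]
    exact tendsto_const_nhds

/-- Telescoping, with the boundary terms moved to opposite sides because subtraction in `ENNReal` is
truncated. -/
lemma cesaro_add_eq (f : ℝ → ENNReal) (n : ℕ) (x : ℝ) :
    cesaro (fun i => R.transfer^[i] f) n x + ((n + 1 : ℕ) : ENNReal)⁻¹ * R.transfer^[n + 1] f x =
      R.transfer (cesaro (fun i => R.transfer^[i] f) n) x + ((n + 1 : ℕ) : ENNReal)⁻¹ * f x := by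
  have h : R.transfer (cesaro (fun i => R.transfer^[i] f) n) x =
      ((n + 1 : ℕ) : ENNReal)⁻¹ * ∑ i ∈ Finset.range (n + 1), R.transfer^[i + 1] f x := by
    unfold cesaro
    rw [R.transfer_const_mul, R.transfer_sum]
    simp only [Function.iterate_succ_apply']
  rw [h, cesaro, ← mul_add, ← mul_add, ← Finset.sum_range_succ (fun i => R.transfer^[i] f x),
    Finset.sum_range_succ']
  rfl

/-- The random map has an invariant decreasing density in some cone. -/
lemma exists_invariant_density (hA : R.ConditionA) {δ : ℝ} (hδ : 0 < δ)
    (hp : ∀ k, ∀ x ∈ unitI, δ ≤ R.p k x) (k : Fin K) :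
    ∃ (h : ℝ → ENNReal) (C : ℝ), InCone (R.exponent k) C h ∧ ∫⁻ x in Ioo 0 1, h x = 1 ∧
      R.transfer h = h := by
  have ha := R.exponent_pos k
  have ha' : 0 < 1 - R.exponent k := by linarith [R.exponent_lt_one k]
  set one : ℝ → ENNReal := (Ioo (0 : ℝ) 1).indicator 1
  have hmass : ∫⁻ x in Ioo 0 1, one x = 1 := by
    rw [setLIntegral_congr_fun measurableSet_Ioo
      (g := fun _ => 1) fun x hx => by simp only [one, indicator_of_mem hx, Pi.one_apply]]
    simp
  set C : ℝ := max 1 (4 * 1 / (δ * (1 - R.exponent k)))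
  have hC1 : 1 ≤ C := le_max_left _ _
  have hC : 4 * 1 ≤ δ * C * (1 - R.exponent k) := by
    have h : 4 * 1 / (δ * (1 - R.exponent k)) ≤ C := le_max_right _ _
    rw [div_le_iff₀ (by positivity)] at h
    linarith
  have hone : InCone (R.exponent k) C one :=
    (isDecreasing_indicator_one.inCone ha.le zero_le_one fun x hx => by
      rw [indicator_of_mem hx, ENNReal.ofReal_one, Pi.one_apply]).mono hC1
  have hcone : ∀ n, InCone (R.exponent k) C (R.transfer^[n] one) := fun n =>
    R.inCone_transfer_iterate hA hδ hp k zero_le_one hC hone (by simp [hmass]) n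
  obtain ⟨h, hh⟩ := exists_tendsto_cesaro fun i => R.transfer^[i] one
  have hdec : IsDecreasing h := by
    constructor
    · intro x hx y hy hxy
      refine le_of_tendsto_of_tendsto' (hh y) (hh x) fun n => ?_
      unfold cesaro
      gcongr with i
      exact (hcone i).antitoneOn hx hy hxy
    · intro x hx
      refine tendsto_nhds_unique (hh x) ?_
      have h0 : ∀ n, cesaro (fun i => R.transfer^[i] one) n x = 0 := fun n =>
        le_antisymm (cesaro_le (fun i => ((hcone i).eq_zero x hx).le) n) zero_le
      simp only [h0]
      exact tendsto_const_nhds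
  have hle : ∀ x ∈ Ioo (0 : ℝ) 1, h x ≤ ENNReal.ofReal (C * x ^ (-R.exponent k)) := fun x hx =>
    le_of_tendsto' (hh x) fun n => cesaro_le (fun i => (hcone i).le_rpow hx) n
  have hinv : R.transfer h = h := by
    funext x
    by_cases hx : x ∈ Ioo (0 : ℝ) 1
    · have h1 := (hh x).add (tendsto_natCast_succ_inv_mul ENNReal.ofReal_ne_top
        fun n => (hcone (n + 1)).le_rpow hx)
      have h2 := (R.tendsto_transfer hh x).add (tendsto_natCast_succ_inv_mul ENNReal.ofReal_ne_top
        fun _ => hone.le_rpow hx)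
      simp only [cesaro_add_eq, add_zero] at h1 h2
      exact tendsto_nhds_unique h2 h1
    · rw [R.transfer_of_notMem h hx]
      refine tendsto_nhds_unique tendsto_const_nhds ((hh x).congr fun n => ?_)
      refine le_antisymm (cesaro_le (fun i => ?_) n) zero_le
      cases i with
      | zero => exact (indicator_of_notMem hx _).le
      | succ i => rw [Function.iterate_succ_apply', R.transfer_of_notMem _ hx]
  -- The mass of the limit is not tracked exactly. The lower bound at `x₀` keeps it positive,
  -- domination by `C x^(-a)` keeps it finite, and dividing by it finishes.
  obtain ⟨x₀, hx₀, hlow⟩ := exists_forall_inCone_ge (C := C) (R.exponent_lt_one k) one_pos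
  have hx₀h : ENNReal.ofReal (1 / 2) ≤ h x₀ := ge_of_tendsto' (hh x₀) fun n =>
    le_cesaro (fun i => hlow _ (hcone i) (by
      rw [R.lintegral_transfer_iterate hA hone.toIsDecreasing, hmass, ENNReal.ofReal_one])) n
  have hhc := inCone_of_le_rpow (R.exponent_lt_one k) (by linarith) hdec hle
  set m := ∫⁻ x in Ioo 0 1, h x with hm
  have hm0 : m ≠ 0 := by
    have h1 : ENNReal.ofReal x₀ * ENNReal.ofReal (1 / 2) ≤ m :=
      (mul_le_mul_right hx₀h _).trans ((hdec.mul_le_lintegral hx₀).trans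
        (lintegral_mono_set (Ioo_subset_Ioo_right hx₀.2.le)))
    have h2 : 0 < ENNReal.ofReal x₀ * ENNReal.ofReal (1 / 2) :=
      ENNReal.mul_pos (by simpa using hx₀.1) (by simp)
    exact (h2.trans_le h1).ne'
  have hmtop : m ≠ ⊤ := by
    have hhalf : (1 / 2 : ℝ) ∈ Ioo (0 : ℝ) 1 := by norm_num
    have h1 : m ≤ (∫⁻ x in Ioo 0 (1 / 2), h x) + ∫⁻ _ in Ico (1 / 2 : ℝ) 1, h (1 / 2) := by
      rw [hm, ← Ioo_union_Ico_eq_Ioo hhalf.1 hhalf.2.le]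
      refine (lintegral_union_le _ _ _).trans (add_le_add le_rfl ?_)
      exact setLIntegral_mono' measurableSet_Ico fun z hz =>
        hdec.antitoneOn hhalf.1 (hhalf.1.trans_le hz.1) hz.1
    refine ne_top_of_le_ne_top (ENNReal.add_ne_top.2 ⟨?_, ?_⟩) h1
    · exact ne_top_of_le_ne_top ENNReal.ofReal_ne_top (hhc.lintegral_le _ hhalf)
    · rw [setLIntegral_const, Real.volume_Ico]
      exact ENNReal.mul_ne_top (ne_top_of_le_ne_top ENNReal.ofReal_ne_top (hle _ hhalf))
        ENNReal.ofReal_ne_top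
  have hinvm : ENNReal.ofReal m⁻¹.toReal = m⁻¹ := ENNReal.ofReal_toReal (ENNReal.inv_ne_top.2 hm0)
  refine ⟨fun x => ENNReal.ofReal m⁻¹.toReal * h x, _, hhc.const_mul ENNReal.toReal_nonneg,
    ?_, ?_⟩
  · rw [lintegral_const_mul' _ _ ENNReal.ofReal_ne_top, hinvm]
    exact ENNReal.inv_mul_cancel hm0 hmtop
  · funext x
    rw [R.transfer_const_mul, hinv]

lemma exists_pos_le_of_transfer_eq (hA : R.ConditionA) {δ : ℝ} (hδ : 0 < δ)
    (hp : ∀ k, ∀ x ∈ unitI, δ ≤ R.p k x) (k : Fin K) {h : ℝ → ENNReal} {C : ℝ}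
    (hh : InCone (R.exponent k) C h) (hmass : ∫⁻ x in Ioo 0 1, h x = 1)
    (hinv : R.transfer h = h) :
    ∃ c : ℝ, 0 < c ∧ ∀ x ∈ Ioo (0 : ℝ) 1, ENNReal.ofReal c ≤ h x := by
  obtain ⟨x₀, hx₀, hlow⟩ := exists_forall_inCone_ge (C := C) (R.exponent_lt_one k) one_pos
  obtain ⟨N, c, hc, hN⟩ := R.exists_forall_le_transfer_iterate hA hδ hp k hx₀.1
  refine ⟨c * (1 / 2), by positivity, fun x hx => ?_⟩
  have h1 := hN h hh.toIsDecreasing x hx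
  rw [Function.iterate_fixed hinv] at h1
  refine le_trans ?_ h1
  rw [ENNReal.ofReal_mul hc.le]
  gcongr
  exact hlow h hh (by rw [hmass, ENNReal.ofReal_one])

end IntermittentRandomMap

/-! ### Approximating densities by differences of decreasing functions -/

lemma exists_polynomial_lintegral_le {r : ℝ → ENNReal} (hr : Measurable r)
    (hr' : ∫⁻ x in Ioo 0 1, r x ≠ ⊤) {ε : ℝ} (hε : 0 < ε) :
    ∃ P : Polynomial ℝ,
      ∫⁻ x in Ioo 0 1, ENNReal.ofReal |(r x).toReal - P.eval x| ≤ ENNReal.ofReal ε := by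
  have hint : Integrable (fun x => (r x).toReal) (volume.restrict (Ioo 0 1)) :=
    integrable_toReal_of_lintegral_ne_top hr.aemeasurable hr'
  obtain ⟨g, -, hg, hgc, hgi⟩ := hint.exists_hasCompactSupport_integral_sub_le (half_pos hε)
  obtain ⟨P, hP⟩ := exists_polynomial_near_of_continuousOn 0 1 g hgc.continuousOn (ε / 2)
    (half_pos hε)
  refine ⟨P, ?_⟩
  calc _ ≤ ∫⁻ x in Ioo 0 1, (ENNReal.ofReal ‖(r x).toReal - g x‖ + ENNReal.ofReal (ε / 2)) := by
        refine setLIntegral_mono' measurableSet_Ioo fun x hx => ?_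
        rw [← ENNReal.ofReal_add (norm_nonneg _) (half_pos hε).le]
        refine ENNReal.ofReal_le_ofReal ((abs_sub_le _ (g x) _).trans ?_)
        rw [abs_sub_comm (g x), Real.norm_eq_abs]
        exact add_le_add_right (hP x (Ioo_subset_Icc_self hx)).le _
    _ ≤ ENNReal.ofReal (ε / 2) + ENNReal.ofReal (ε / 2) := by
        rw [lintegral_add_right _ measurable_const, setLIntegral_const, Real.volume_Ioo, sub_zero,
          ENNReal.ofReal_one, mul_one,
          ← ofReal_integral_eq_lintegral_ofReal (f := fun x => ‖(r x).toReal - g x‖)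
            (hint.sub hgi).norm
            (Filter.Eventually.of_forall fun _ => norm_nonneg _)]
        gcongr
    _ = _ := by rw [← ENNReal.ofReal_add (half_pos hε).le (half_pos hε).le, add_halves]

/-- A polynomial is a difference of two nonnegative decreasing functions on the unit interval. -/
lemma exists_antitoneOn_sub_eq_polynomial (P : Polynomial ℝ) :
    ∃ (B : ℝ) (u v : ℝ → ℝ), 0 ≤ B ∧ AntitoneOn u (Icc 0 1) ∧ AntitoneOn v (Icc 0 1) ∧
      (∀ x ∈ Icc (0 : ℝ) 1, u x ∈ Icc 0 B) ∧ (∀ x ∈ Icc (0 : ℝ) 1, v x ∈ Icc 0 B) ∧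
      ∀ x, u x - v x = P.eval x := by
  obtain ⟨K₁, h₁⟩ := isCompact_Icc.exists_bound_of_continuousOn (s := Icc (0 : ℝ) 1)
    P.continuous.continuousOn
  obtain ⟨K₂, h₂⟩ := isCompact_Icc.exists_bound_of_continuousOn (s := Icc (0 : ℝ) 1)
    P.derivative.continuous.continuousOn
  set L := max K₁ K₂
  have hL₁ : ∀ x ∈ Icc (0 : ℝ) 1, |P.eval x| ≤ L := fun x hx =>
    (h₁ x hx).trans (le_max_left _ _)
  have hL₂ : ∀ x ∈ Icc (0 : ℝ) 1, |P.derivative.eval x| ≤ L := fun x hx =>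
    (h₂ x hx).trans (le_max_right _ _)
  have hL : 0 ≤ L := (abs_nonneg _).trans (hL₁ 0 (by simp))
  -- `L` bounds both `|P|` and `|P'|`: slope `-L` makes the sum decreasing, and `2L - Lx ≥ L` makes
  -- it nonnegative.
  refine ⟨3 * L, fun x => P.eval x + (2 * L - L * x), fun x => 2 * L - L * x, by linarith,
    ?_, ?_, ?_, ?_, fun x => by ring⟩
  · have hd : ∀ x, HasDerivAt (fun x => P.eval x + (2 * L - L * x))
        (P.derivative.eval x + -(L * 1)) x := fun x =>
      (P.hasDerivAt x).add (((hasDerivAt_id x).const_mul L).const_sub (2 * L))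
    refine antitoneOn_of_deriv_nonpos (convex_Icc 0 1)
      (fun x _ => (hd x).continuousAt.continuousWithinAt)
      (fun x _ => (hd x).differentiableAt.differentiableWithinAt) fun x hx => ?_
    rw [(hd x).deriv]
    have := (abs_le.1 (hL₂ x (interior_subset hx))).2
    linarith
  · intro x _ y _ hxy
    have := mul_le_mul_of_nonneg_left hxy hL
    dsimp only
    linarith
  · intro x hx
    have h := abs_le.1 (hL₁ x hx)
    exact ⟨by nlinarith [hx.1, hx.2], by nlinarith [hx.1, hx.2]⟩
  · intro x hx
    exact ⟨by nlinarith [hx.1, hx.2], by nlinarith [hx.1, hx.2]⟩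

lemma isDecreasing_ofReal {u : ℝ → ℝ} (hu : AntitoneOn u (Icc 0 1)) :
    IsDecreasing ((Ioo (0 : ℝ) 1).indicator fun x => ENNReal.ofReal (u x)) :=
  .of_Ioo (fun x hx y hy hxy => by
    rw [indicator_of_mem hx, indicator_of_mem hy]
    exact ENNReal.ofReal_le_ofReal
      (hu (Ioo_subset_Icc_self hx) (Ioo_subset_Icc_self hy) hxy))
    fun _ hx => indicator_of_notMem (fun h => h.2.not_ge hx) _

/-! ### Invariant measures and uniqueness -/

namespace IntermittentRandomMap

variable {K : ℕ} (R : IntermittentRandomMap K)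

lemma pushMeasure_eq {ν : Measure ℝ} (hν : ν ≪ leb) (A : Set ℝ) :
    R.pushMeasure ν A = ∫⁻ x, R.dual (A.indicator 1) x ∂ν := by
  have h : ∀ᵐ x ∂ν, x ∈ unitI := hν.ae_le (ae_restrict_mem measurableSet_Icc)
  rw [pushMeasure, Measure.restrict_eq_self_of_ae_mem h]
  refine lintegral_congr_ae (h.mono fun x hx => ?_)
  simp only [transition, dual, R.measurableT_eq _ hx]

/-- Invariance is given on sets. Writing `E_T ν` as an actual measure, a finite sum of push-forwards
of `p_k ν`, extends it to all measurable test functions. -/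
lemma lintegral_dual_of_invariant {ν : Measure ℝ} (hν : ν ≪ leb) (hinv : R.Invariant ν)
    {φ : ℝ → ENNReal} (hφ : Measurable φ) : ∫⁻ x, R.dual φ x ∂ν = ∫⁻ x, φ x ∂ν := by
  set ν' : Measure ℝ := ∑ k, (ν.withDensity fun x => ENNReal.ofReal (R.p k x)).map
    (R.measurableT k) with hν'
  have h : ∀ φ : ℝ → ENNReal, Measurable φ → ∫⁻ x, φ x ∂ν' = ∫⁻ x, R.dual φ x ∂ν := by
    intro φ hφ
    have hp := fun k => (R.p_measurable k).ennreal_ofReal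
    have hT := R.measurable_measurableT
    rw [hν', lintegral_finsetSum_measure]
    simp only [dual]
    rw [lintegral_finsetSum _ fun k _ => (hp k).fun_mul (g := fun x => φ (R.measurableT k x))
      (hφ.comp (hT k))]
    refine Finset.sum_congr rfl fun k _ => ?_
    rw [lintegral_map hφ (hT k), lintegral_withDensity_eq_lintegral_mul _ (hp k)
      (g := fun x => φ (R.measurableT k x)) (hφ.comp (hT k))]
    rfl
  have heq : ν' = ν := by
    ext A hA
    rw [← hinv A hA, R.pushMeasure_eq hν, ← h _ (measurable_one.indicator hA),
      lintegral_indicator_one hA]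
  rw [← h φ hφ, heq]

lemma lintegral_dual_iterate_of_invariant {ν : Measure ℝ} (hν : ν ≪ leb) (hinv : R.Invariant ν)
    {φ : ℝ → ENNReal} (hφ : Measurable φ) (n : ℕ) :
    ∫⁻ x, R.dual^[n] φ x ∂ν = ∫⁻ x, φ x ∂ν := by
  induction n with
  | zero => rfl
  | succ n ih =>
    rw [Function.iterate_succ_apply',
      R.lintegral_dual_of_invariant hν hinv (R.measurable_dual_iterate hφ n), ih]

lemma invariant_withDensity (hA : R.ConditionA) {h : ℝ → ENNReal} (hh : IsDecreasing h)
    (hinv : R.transfer h = h) : R.Invariant (leb.withDensity h) := by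
  intro A hAm
  have hm : AEMeasurable h leb := by rw [leb_eq]; exact hh.aemeasurable
  have hone : Measurable (A.indicator (1 : ℝ → ENNReal)) := measurable_one.indicator hAm
  rw [R.pushMeasure_eq (withDensity_absolutelyContinuous _ _), ← lintegral_indicator_one hAm,
    lintegral_withDensity_eq_lintegral_mul₀ hm (R.measurable_dual hone).aemeasurable,
    lintegral_withDensity_eq_lintegral_mul₀ hm hone.aemeasurable, leb_eq]
  simp only [Pi.mul_apply]
  rw [← R.lintegral_transfer_mul hA hh hone, hinv]

/-- Any absolutely continuous invariant probability measure is below the one with an invariant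
decreasing density. -/
lemma measure_le_withDensity (hA : R.ConditionA) {δ : ℝ} (hδ : 0 < δ)
    (hp : ∀ k, ∀ x ∈ unitI, δ ≤ R.p k x) (k : Fin K) {h : ℝ → ENNReal} {C : ℝ}
    (hh : InCone (R.exponent k) C h) (hmass : ∫⁻ x in Ioo 0 1, h x = 1)
    (hinv : R.transfer h = h) {ν : Measure ℝ} (hν : R.IsACIM ν) : ν ≤ leb.withDensity h := by
  have := hν.isProbability
  have ha := R.exponent_pos k
  refine Measure.le_iff.2 fun B hB => ?_
  set μ := leb.withDensity h
  have hm : AEMeasurable h leb := by rw [leb_eq]; exact hh.aemeasurable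
  have hint : ∀ φ : ℝ → ENNReal, Measurable φ → ∫⁻ x, φ x ∂μ = ∫⁻ x in Ioo 0 1, h x * φ x := by
    intro φ hφ
    rw [lintegral_withDensity_eq_lintegral_mul₀ hm hφ.aemeasurable, leb_eq]
    rfl
  have hμ1 : μ univ = 1 := by
    have := hint 1 measurable_one
    simpa [hmass] using this
  have hμB : μ B ≤ 1 := hμ1 ▸ measure_mono (subset_univ B)
  have : SigmaFinite leb := by rw [leb_eq]; infer_instance
  set r := ν.rnDeriv leb with hr
  have hrm : Measurable r := Measure.measurable_rnDeriv _ _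
  have hνr : ∀ φ : ℝ → ENNReal, Measurable φ → ∫⁻ x, φ x ∂ν = ∫⁻ x in Ioo 0 1, r x * φ x := by
    intro φ hφ
    conv_lhs => rw [← Measure.withDensity_rnDeriv_eq ν leb hν.absolutelyContinuous]
    rw [lintegral_withDensity_eq_lintegral_mul _ hrm hφ, leb_eq]
    rfl
  have hr1 : ∫⁻ x in Ioo 0 1, r x = 1 := by
    have := hνr 1 measurable_one
    simpa using this.symm
  refine ENNReal.le_of_forall_pos_le_add fun ε hε _ => ?_
  have hε4 : (0 : ℝ) < ε / 4 := by positivity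
  obtain ⟨P, hP⟩ := exists_polynomial_lintegral_le hrm (by rw [hr1]; exact ENNReal.one_ne_top) hε4
  obtain ⟨L, u, v, hL, hu, hv, huL, hvL, huv⟩ := exists_antitoneOn_sub_eq_polynomial P
  set F : (ℝ → ℝ) → ℝ → ENNReal := fun u => (Ioo (0 : ℝ) 1).indicator fun x => ENNReal.ofReal (u x)
  set e : ℝ → ENNReal := fun x => ENNReal.ofReal |(r x).toReal - P.eval x|
  have hem : Measurable e := (hrm.ennreal_toReal.sub P.continuous.measurable).abs.ennreal_ofReal
  have hcone : ∀ u : ℝ → ℝ, AntitoneOn u (Icc 0 1) → (∀ x ∈ Icc (0 : ℝ) 1, u x ∈ Icc 0 L) →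
      InCone (R.exponent k) L (F u) ∧ ∫⁻ x in Ioo 0 1, F u x ≠ ⊤ := by
    intro u hu huL
    have hle : ∀ x ∈ Ioo (0 : ℝ) 1, F u x ≤ ENNReal.ofReal L := fun x hx => by
      simp only [F, indicator_of_mem hx]
      exact ENNReal.ofReal_le_ofReal (huL x (Ioo_subset_Icc_self hx)).2
    refine ⟨(isDecreasing_ofReal hu).inCone ha.le hL hle, ?_⟩
    refine ne_top_of_le_ne_top (ENNReal.ofReal_ne_top (r := L))
      ((setLIntegral_mono' measurableSet_Ioo hle).trans_eq ?_)
    simp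
  obtain ⟨huC, huT⟩ := hcone u hu huL
  obtain ⟨hvC, hvT⟩ := hcone v hv hvL
  set Mu := ∫⁻ x in Ioo 0 1, F u x
  set Mv := ∫⁻ x in Ioo 0 1, F v x
  have hmassMul : ∀ M : ENNReal, ∫⁻ x in Ioo 0 1, ENNReal.ofReal M.toReal * h x =
      ENNReal.ofReal M.toReal := fun M => by
    rw [lintegral_const_mul' _ _ ENNReal.ofReal_ne_top, hmass, mul_one]
  -- The density `r` is close to `u - v`, so an upper bound on `ν B` needs `u` compared from above
  -- with `Mu • h` and `v` from below with `Mv • h`.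
  obtain ⟨N₁, hN₁⟩ := R.exists_forall_lintegral_dual_le hA hδ hp k ENNReal.toReal_nonneg huC
    (hh.const_mul (ENNReal.toReal_nonneg (a := Mu))) (ENNReal.ofReal_toReal huT).symm
    (hmassMul Mu) hε4
  obtain ⟨N₂, hN₂⟩ := R.exists_forall_lintegral_dual_le hA hδ hp k ENNReal.toReal_nonneg
    (hh.const_mul (ENNReal.toReal_nonneg (a := Mv))) hvC (hmassMul Mv)
    (ENNReal.ofReal_toReal hvT).symm hε4
  set φ : ℝ → ENNReal := B.indicator 1
  have hφ : Measurable φ := measurable_one.indicator hB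
  have hφ1 : ∀ x ∈ unitI, φ x ≤ 1 := fun x _ => indicator_le_self' (f := 1) (fun _ _ => zero_le) x
  set n := max N₁ N₂
  set ψ := R.dual^[n] φ
  have hψ : Measurable ψ := R.measurable_dual_iterate hφ n
  have hψ1 : ∀ x ∈ Ioo (0 : ℝ) 1, ψ x ≤ 1 := fun x hx =>
    R.dual_iterate_le_one hφ1 n x (Ioo_subset_Icc_self hx)
  have hhψ : ∀ M : ENNReal, M ≠ ⊤ →
      ∫⁻ x in Ioo 0 1, ENNReal.ofReal M.toReal * h x * ψ x = M * μ B := fun M hM => by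
    simp only [mul_assoc]
    rw [lintegral_const_mul' _ _ ENNReal.ofReal_ne_top, ← hint ψ hψ,
      R.lintegral_dual_iterate_of_invariant (withDensity_absolutelyContinuous _ _)
        (R.invariant_withDensity hA hh.toIsDecreasing hinv) hφ, lintegral_indicator_one hB,
      ENNReal.ofReal_toReal hM]
  have hνψ : ν B = ∫⁻ x in Ioo 0 1, r x * ψ x := by
    rw [← hνr ψ hψ, R.lintegral_dual_iterate_of_invariant hν.absolutelyContinuous hν.invariant hφ,
      lintegral_indicator_one hB]
  have h1 := hN₁ n (le_max_left _ _) φ hφ hφ1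
  have h2 := hN₂ n (le_max_right _ _) φ hφ hφ1
  rw [hhψ Mu huT] at h1
  rw [hhψ Mv hvT] at h2
  have hrfin : ∀ᵐ x ∂(volume.restrict (Ioo (0 : ℝ) 1)), r x < ⊤ :=
    ae_lt_top hrm (by rw [hr1]; exact ENNReal.one_ne_top)
  have h3 : (∫⁻ x in Ioo 0 1, r x * ψ x) + ∫⁻ x in Ioo 0 1, F v x * ψ x ≤
      (∫⁻ x in Ioo 0 1, F u x * ψ x) + ENNReal.ofReal (ε / 4) := by
    refine le_trans ?_ (add_le_add le_rfl hP)
    rw [← lintegral_add_left (hrm.fun_mul hψ), ← lintegral_add_right _ hem]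
    refine lintegral_mono_ae ?_
    filter_upwards [hrfin, ae_restrict_mem measurableSet_Ioo] with x hx hx01
    have hmain : r x + F v x ≤ F u x + e x := by
      simp only [F, e, indicator_of_mem hx01]
      have hux := (huL x (Ioo_subset_Icc_self hx01)).1
      have hvx := (hvL x (Ioo_subset_Icc_self hx01)).1
      nth_rewrite 1 [← ENNReal.ofReal_toReal hx.ne]
      rw [← ENNReal.ofReal_add ENNReal.toReal_nonneg hvx,
        ← ENNReal.ofReal_add hux (abs_nonneg _)]
      refine ENNReal.ofReal_le_ofReal ?_
      have := le_abs_self ((r x).toReal - P.eval x)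
      linarith [huv x]
    calc r x * ψ x + F v x * ψ x = (r x + F v x) * ψ x := by ring
      _ ≤ (F u x + e x) * ψ x := by gcongr
      _ = F u x * ψ x + e x * ψ x := by ring
      _ ≤ _ := by
        gcongr
        exact mul_le_of_le_one_right zero_le (hψ1 x hx01)
  have h4 : Mu ≤ 1 + Mv + ENNReal.ofReal (ε / 4) := by
    refine le_trans ?_ (add_le_add le_rfl hP)
    rw [← hr1, ← lintegral_add_left hrm, ← lintegral_add_right _ hem]
    refine lintegral_mono_ae ?_
    filter_upwards [hrfin, ae_restrict_mem measurableSet_Ioo] with x hx hx01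
    simp only [F, e, indicator_of_mem hx01]
    have hvx := (hvL x (Ioo_subset_Icc_self hx01)).1
    nth_rewrite 1 [← ENNReal.ofReal_toReal hx.ne]
    rw [← ENNReal.ofReal_add ENNReal.toReal_nonneg hvx,
      ← ENNReal.ofReal_add (by positivity) (abs_nonneg _)]
    refine ENNReal.ofReal_le_ofReal ?_
    have := neg_abs_le ((r x).toReal - P.eval x)
    linarith [huv x]
  -- The four quarters: the two couplings, the `L¹` error in `h3`, and the same error in the mass
  -- comparison `h4`.
  set q := ENNReal.ofReal (ε / 4)
  have hq : q + q + q + q = ε := by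
    simp only [q]
    rw [← ENNReal.ofReal_add hε4.le hε4.le, ← ENNReal.ofReal_add (by positivity) hε4.le,
      ← ENNReal.ofReal_add (by positivity) hε4.le, ← ENNReal.ofReal_coe_nnreal]
    congr 1
    ring
  have hfin : Mv * μ B ≠ ⊤ := ENNReal.mul_ne_top hvT (ne_top_of_le_ne_top ENNReal.one_ne_top hμB)
  -- The term `Mv * μ B` stays on both sides and is cancelled at the end, which is allowed since it
  -- is finite.
  have h5 : Mv * μ B + ν B ≤ Mv * μ B + (μ B + ε) := by
    calc Mv * μ B + ν B ≤ (∫⁻ x in Ioo 0 1, F v x * ψ x) + q + ν B := by gcongr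
      _ = ((∫⁻ x in Ioo 0 1, r x * ψ x) + ∫⁻ x in Ioo 0 1, F v x * ψ x) + q := by
          rw [hνψ]; ring
      _ ≤ ((∫⁻ x in Ioo 0 1, F u x * ψ x) + q) + q := by gcongr
      _ ≤ (Mu * μ B + q) + q + q := by gcongr
      _ ≤ ((1 + Mv + q) * μ B + q) + q + q := by gcongr
      _ = Mv * μ B + (μ B + (q * μ B + q + q + q)) := by ring
      _ ≤ Mv * μ B + (μ B + (q + q + q + q)) := by
          gcongr
          exact mul_le_of_le_one_right zero_le hμB
      _ = _ := by rw [hq]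
  exact (ENNReal.add_le_add_iff_left hfin).1 h5

end IntermittentRandomMap

end

theorem theorem3p1 {K : ℕ} (R : IntermittentRandomMap K)
    (hA : R.ConditionA) (hB : R.ConditionB) :
    ∃ (μ : Measure ℝ) (ρ : ℝ → ℝ),
      R.IsACIM μ ∧ (∀ ν : Measure ℝ, R.IsACIM ν → ν = μ) ∧
      Measurable ρ ∧ μ = leb.withDensity (fun x => ENNReal.ofReal (ρ x)) ∧
      ∃ c : ℝ, 0 < c ∧ ∀ᵐ x ∂leb, c ≤ ρ x := by
  obtain ⟨δ, hδ, hp⟩ := hB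
  -- `K ≥ 1` is forced, since an empty sum of probabilities cannot be `1`. Any `k` serves to define
  -- the cone.
  obtain ⟨k⟩ : Nonempty (Fin K) := by
    by_contra hK
    rw [not_nonempty_iff] at hK
    simpa using R.p_sum 0 (by simp [unitI])
  obtain ⟨h, C, hh, hmass, hinv⟩ := R.exists_invariant_density hA hδ hp k
  obtain ⟨c, hc, hch⟩ := R.exists_pos_le_of_transfer_eq hA hδ hp k hh hmass hinv
  have hm : AEMeasurable h leb := by rw [leb_eq]; exact hh.aemeasurable
  have hmass' : ∫⁻ x, h x ∂leb = 1 := by rw [leb_eq]; exact hmass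
  have hfin : ∀ᵐ x ∂leb, h x < ⊤ := ae_lt_top' hm (by rw [hmass']; exact ENNReal.one_ne_top)
  have hprob : IsProbabilityMeasure (leb.withDensity h) := ⟨by
    rw [withDensity_apply _ MeasurableSet.univ, setLIntegral_univ, hmass']⟩
  refine ⟨leb.withDensity h, fun x => (hm.mk h x).toReal, ⟨hprob,
    withDensity_absolutelyContinuous _ _, R.invariant_withDensity hA hh.toIsDecreasing hinv⟩,
    fun ν hν => ?_, hm.measurable_mk.ennreal_toReal, ?_, c, hc, ?_⟩
  · have := hν.isProbability
    exact Measure.eq_of_le_of_isProbabilityMeasure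
      (R.measure_le_withDensity hA hδ hp k hh hmass hinv hν)
  · refine withDensity_congr_ae ?_
    filter_upwards [hm.ae_eq_mk, hfin] with x hx hx'
    rw [← hx, ENNReal.ofReal_toReal hx'.ne]
  · have hmem : ∀ᵐ x ∂leb, x ∈ Ioo (0 : ℝ) 1 := by
      rw [leb_eq]; exact ae_restrict_mem measurableSet_Ioo
    filter_upwards [hm.ae_eq_mk, hfin, hmem] with x hx hx' hx01
    rw [← hx]
    exact (ENNReal.ofReal_le_iff_le_toReal hx'.ne).1 (hch x hx01)
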